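/- Let $\mathbb K$ be an algebraically closed field of characteristic $0$, $\mathfrak g$ a finite dimensional simple Lie algebra over $\mathbb K$, $e$ a nilpotent element of $\mathfrak g$, and $(e,h,f)$ an $\mathfrak{sl}_2$-triple in $\mathfrak g$ containing $e$. For $x\in\mathfrak g$ let $\mathfrak g(x)$ be the centralizer of $x$ in $\mathfrak g$, and put $\mathfrak l=\mathfrak g(e)\cap\mathfrak g(f)$. Let $\mathfrak t$ be a subspace of a Cartan subalgebra of $\mathfrak l$, $\mathfrak a$ the centralizer of $\mathfrak t$ in $\mathfrak g$, and $\mathfrak a(e)=\mathfrak a\cap\mathfrak g(e)$. For $\mu\in\mathfrak t^*$ let $E_\mu=\{v\in\mathfrak g(e) : [t,v]=\mu(t)v \text{ for all } t\in\mathfrak t\}$. The spaces $E_\mu$ and $E_{-\mu}$ have the same dimension; given bases $v_1,\dots,v_k$ of $E_\mu$ and $w_1,\dots,w_k$ of $E_{-\mu}$, let $M_\mu=([v_i,w_j])_{1\le i,j\le k}$, a matrix with coefficients in the symmetric algebra $S(\mathfrak g(e))$, and $\delta_\mu=\det M_\mu$, which up to a nonzero scalar does not depend on the bases. The index of a finite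 dimensional Lie algebra $\mathfrak q$ is the smallest dimension of the stabilizers $\{v\in\mathfrak q : x([v,w])=0 \text{ for all } w\in\mathfrak q\}$, $x\in\mathfrak q^*$. Let $d$ be the biggest eigenvalue of $\operatorname{ad} h$ on $\mathfrak g$ (these eigenvalues are integers). Suppose that: 1) $\ker(\operatorname{ad}h-d)$ has dimension at most $3$ and does not centralize $\mathfrak t$; 2) if $\ker(\operatorname{ad}h-d)$ has dimension $3$, then $\mathfrak t$ is contained in the center of $\mathfrak l$; 3) $\delta_\mu\neq0$ for every nonzero weight $\mu$ of $\mathfrak t$ in $\mathfrak g(e)$ which is not a weight of $\mathfrak t$ in $\ker(\operatorname{ad}h-d)$; 4) for every nonzero weight $\lambda$ of $\mathfrak t$ in $\ker(\operatorname{ad}h-d)$, with $k=\dim E_\lambda$, for some choice of bases of $E_\lambda$ and $E_{-\lambda}$ the matrix $M_\lambda$ has a nonzero principal minor of order $k-1$ (obtained by deleting the $i$-th row and the $i$-th column for some $i$; the minor of order $0$ is $1$). Then the index of $\mathfrak a(e)$ is greater than or equal to the index of $\mathfrak g(e)$. -/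

import Mathlib

noncomputable section

namespace NilpotentCentralizer

section Index

variable (K L : Type*) [Field K] [LieRing L] [LieAlgebra K L]

/-- The stabilizer `L(x) = {v ∈ L | v.x = 0}` of a linear form `x` on the Lie algebra `L`, for the
coadjoint action `(v.x)(w) = -x([v, w])` of `L` on its dual. -/
def coadjointStabilizer (x : Module.Dual K L) : Submodule K L where
  carrier := {v | ⁅v, x⁆ = 0}
  add_mem' := by
    intro a b ha hb
    change ⁅a, x⁆ = 0 at ha
    change ⁅b, x⁆ = 0 at hb
    change ⁅a + b, x⁆ = 0
    rw [add_lie, ha, hb, add_zero]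
  zero_mem' := zero_lie x
  smul_mem' := by
    intro c a ha
    change ⁅a, x⁆ = 0 at ha
    change ⁅c • a, x⁆ = 0
    rw [smul_lie, ha, smul_zero]

/-- The index of a finite dimensional Lie algebra: the smallest dimension of the stabilizers of
linear forms for the coadjoint action. -/
def index : ℕ := ⨅ x : Module.Dual K L, Module.finrank K (coadjointStabilizer K L x)

end Index

variable {K : Type*} {𝔤 : Type*} [Field K] [LieRing 𝔤] [LieAlgebra K 𝔤]

variable (K) in
/-- The centralizer in `𝔤` of a subset `s` of `𝔤`. -/
def centralizer (s : Set 𝔤) : LieSubalgebra K 𝔤 where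
  carrier := {v | ∀ y ∈ s, ⁅y, v⁆ = 0}
  add_mem' := by
    intro a b ha hb y hy
    rw [lie_add, ha y hy, hb y hy, add_zero]
  zero_mem' := fun y _ => lie_zero y
  smul_mem' := by
    intro c a ha y hy
    rw [lie_smul, ha y hy, smul_zero]
  lie_mem' := by
    intro a b ha hb y hy
    rw [leibniz_lie, ha y hy, hb y hy, zero_lie, lie_zero, add_zero]

variable (K) in
/-- `𝔤(e)`, the centralizer of the element `e` in `𝔤`. -/
abbrev centralizerElt (e : 𝔤) : LieSubalgebra K 𝔤 := centralizer K {e}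

variable (K) in
/-- `𝔩 = 𝔤(e) ∩ 𝔤(f)`. -/
abbrev reductiveFactor (e f : 𝔤) : LieSubalgebra K 𝔤 := centralizerElt K e ⊓ centralizerElt K f

/-- `𝔞(e)`, where `𝔞` is the centralizer of the subspace `𝔱` in `𝔤`: the centralizer of `e`
in `𝔞`. -/
abbrev centralizerIn (𝔱 : Submodule K 𝔤) (e : 𝔤) : LieSubalgebra K 𝔤 :=
  centralizer K (𝔱 : Set 𝔤) ⊓ centralizerElt K e

/-- The subspace of `𝔤` of vectors of weight `μ ∈ 𝔱*` for the adjoint action of the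
subspace `𝔱`. -/
def weightSpace (𝔱 : Submodule K 𝔤) (μ : Module.Dual K 𝔱) : Submodule K 𝔤 where
  carrier := {v | ∀ s : 𝔱, ⁅(s : 𝔤), v⁆ = μ s • v}
  add_mem' := by
    intro a b ha hb s
    rw [lie_add, ha s, hb s, smul_add]
  zero_mem' := fun s => by rw [lie_zero, smul_zero]
  smul_mem' := by
    intro c a ha s
    rw [lie_smul, ha s, smul_comm]

/-- `E_μ`: the weight subspace of weight `μ` for the adjoint action of `𝔱` in `𝔤(e)`. -/
def E (𝔱 : Submodule K 𝔤) (e : 𝔤) (μ : Module.Dual K 𝔱) : Submodule K (centralizerElt K e) :=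
  (weightSpace 𝔱 μ).comap (centralizerElt K e).toSubmodule.subtype

/-- The matrix `M_μ = ([v_i, w_j])` with coefficients in the symmetric algebra of `𝔤(e)`, where
`v` and `w` are bases of `E_μ` and `E_{-μ}`. -/
def bracketMatrix {𝔱 : Submodule K 𝔤} {e : 𝔤} {μ : Module.Dual K 𝔱} {k : ℕ}
    (v : Module.Basis (Fin k) K (E 𝔱 e μ)) (w : Module.Basis (Fin k) K (E 𝔱 e (-μ))) :
    Matrix (Fin k) (Fin k) (SymmetricAlgebra K (centralizerElt K e)) :=
  Matrix.of fun i j => SymmetricAlgebra.ι K (centralizerElt K e)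
    ⁅(v i : centralizerElt K e), (w j : centralizerElt K e)⁆

/-- `ker (ad h - d)`. -/
abbrev adEigenspace (h : 𝔤) (d : K) : Submodule K 𝔤 :=
  LinearMap.ker ((LieAlgebra.ad K 𝔤 h : Module.End K 𝔤) - d • (1 : Module.End K 𝔤))

/-- `μ` is a weight of the adjoint action of `𝔱` in the subspace `V` of `𝔤`: some nonzero vector
of `V` has weight `μ`. -/
def IsWeightIn (𝔱 : Submodule K 𝔤) (V : Submodule K 𝔤) (μ : Module.Dual K 𝔱) : Prop :=
  weightSpace 𝔱 μ ⊓ V ≠ ⊥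

end NilpotentCentralizer

end

/-! The subspace `𝔱` acts on `𝔤(e)` by commuting semisimple operators, so `𝔤(e)` is graded by the
weight spaces `E_μ`, and `E_0 = 𝔞(e)`. A linear form `x` that vanishes on every `E_μ` with `μ ≠ 0`
defines an alternating form `x([v, w])` which only couples `E_μ` with `E_{-μ}`. Its kernel `N` is
therefore graded, and for a good choice of `x` every piece is as small as the hypotheses allow
(`exists_dual_of_graded`): the degree 0 piece has dimension at most the index of `𝔞(e)`. For `μ ≠ 0`
the piece is at most a line, and it is zero unless `μ` and `-μ` are both weights in the top
eigenspace `V` of `ad h`.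

If no such pair occurs, `N` already gives the bound. Otherwise `dim V ≤ 3` leaves room for a single
pair `±μ`, so `dim N` exceeds the index of `𝔞(e)` by at most 2. Two explicit elements of `N` recover
this excess: some `s` in `𝔱` with `μ(s) ≠ 0`, and a weight vector `v` of weight `μ` in `V`, which
commutes with `E_{-μ}` (`lie_eq_zero_of_mem_adEigenspace`). Since `[s, v] = μ(s) v ≠ 0`, some `y`
has `y([s, v]) ≠ 0`, and a suitable `x + c y` has a kernel smaller by at least 2
(`exists_finrank_ker_add_smul_add_two_le`).

Semisimplicity of `𝔱` comes from nondegeneracy of the Killing form on `𝔩`, proved by direct `sl_2`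
computations. -/

noncomputable section

namespace NilpotentCentralizer

open Module

/-! ### Kernels in pencils of linear maps and alternating forms. -/

section Pencil

variable {K : Type*} [Field K]

/-- On a complement `U` of `ker A` the map `A` has a left inverse `P`. A nonzero vector of `U`
killed by `A + s B` is an eigenvector of `P B` on `U` with eigenvalue `-1/s`, which excludes only
finitely many `s`. -/
lemma exists_finset_finrank_ker_add_smul_le {V W : Type*} [AddCommGroup V] [Module K V]
    [FiniteDimensional K V] [AddCommGroup W] [Module K W] (A B : V →ₗ[K] W) :
    ∃ S : Finset K, ∀ s ∉ S,
      finrank K (LinearMap.ker (A + s • B)) ≤ finrank K (LinearMap.ker A) := by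
  classical
  obtain ⟨U, hU⟩ := Submodule.exists_isCompl (LinearMap.ker A)
  have hinj : LinearMap.ker (A.domRestrict U) = ⊥ := by
    rw [LinearMap.ker_eq_bot']
    exact fun u hu => Subtype.ext (Submodule.disjoint_def.1 hU.disjoint u hu u.2)
  obtain ⟨P, hP⟩ := LinearMap.exists_leftInverse_of_injective _ hinj
  have hP' : ∀ u : U, P (A u) = u := fun u => LinearMap.congr_fun hP u
  let M : End K U := P ∘ₗ B.domRestrict U
  have hfin : {c : K | M.HasEigenvalue c}.Finite := Module.End.finite_hasEigenvalue M
  refine ⟨(hfin.toFinset.image fun c => -c⁻¹), fun s hs => ?_⟩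
  have hdisj : Disjoint (LinearMap.ker (A + s • B)) U := by
    rw [Submodule.disjoint_def]
    intro u hu hu'
    by_contra hne
    have h1 : A u + s • B u = 0 := hu
    have h2 : u + s • P (B u) = 0 := by
      simpa [hP' ⟨u, hu'⟩] using congrArg (fun w => ((P w : U) : V)) h1
    have hs0 : s ≠ 0 := by
      rintro rfl
      exact hne (by simpa using h2)
    apply hs
    rw [Finset.mem_image]
    refine ⟨-s⁻¹, ?_, by simp⟩
    rw [Set.Finite.mem_toFinset]
    refine Module.End.hasEigenvalue_of_hasEigenvector (x := (⟨u, hu'⟩ : U)) ⟨?_, ?_⟩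
    · rw [Module.End.mem_eigenspace_iff]
      apply Subtype.ext
      change ((P (B u) : U) : V) = -s⁻¹ • u
      have : s • ((P (B u) : U) : V) = -u := by
        rw [← add_eq_zero_iff_eq_neg, add_comm]
        exact h2
      rw [neg_smul, ← smul_neg, ← this, smul_smul, inv_mul_cancel₀ hs0, one_smul]
    · exact fun h => hne (congrArg Subtype.val h)
  have h1 := Submodule.finrank_add_finrank_le_of_disjoint hdisj
  have h2 := Submodule.finrank_add_eq_of_isCompl hU
  lia

lemma ker_add_smul_swap {V W : Type*} [AddCommGroup V] [Module K V]
    [AddCommGroup W] [Module K W] (A B : V →ₗ[K] W) {s : K} (hs : s ≠ 0) :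
    LinearMap.ker (A + s • B) = LinearMap.ker (B + s⁻¹ • A) := by
  rw [← LinearMap.ker_smul (B + s⁻¹ • A) s hs, smul_add, smul_smul, mul_inv_cancel₀ hs, one_smul,
    add_comm]

/-- Small kernels are an open condition along lines: moving from a point good for `T` towards a
point good for `j`, all but finitely many parameters are good for both. The second bound is read
from the other end of the line, with parameter `s⁻¹`. -/
lemma exists_forall_finrank_ker_le [Infinite K] {ι X : Type*} [AddCommGroup X] [Module K X]
    {V W : ι → Type*} [∀ i, AddCommGroup (V i)] [∀ i, Module K (V i)]
    [∀ i, FiniteDimensional K (V i)] [∀ i, AddCommGroup (W i)] [∀ i, Module K (W i)]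
    (Φ : ∀ i, X →ₗ[K] V i →ₗ[K] W i) (m : ι → ℕ) (T : Finset ι)
    (h : ∀ i ∈ T, ∃ x, finrank K (LinearMap.ker (Φ i x)) ≤ m i) :
    ∃ x, ∀ i ∈ T, finrank K (LinearMap.ker (Φ i x)) ≤ m i := by
  classical
  induction T using Finset.induction_on with
  | empty => exact ⟨0, by simp⟩
  | insert j T hj ih =>
    obtain ⟨x, hx⟩ := ih fun i hi => h i (Finset.mem_insert_of_mem hi)
    obtain ⟨y, hy⟩ := h j (Finset.mem_insert_self _ _)
    choose S hS using fun i => exists_finset_finrank_ker_add_smul_le (Φ i x) (Φ i y)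
    obtain ⟨S', hS'⟩ := exists_finset_finrank_ker_add_smul_le (Φ j y) (Φ j x)
    obtain ⟨s, hs⟩ := Infinite.exists_notMem_finset
      (insert 0 (T.biUnion S ∪ S'.image fun c => c⁻¹))
    simp only [Finset.mem_insert, Finset.mem_union, Finset.mem_biUnion, Finset.mem_image,
      not_or, not_exists, not_and] at hs
    obtain ⟨hs0, hs1, hs2⟩ := hs
    refine ⟨x + s • y, fun i hi => ?_⟩
    rw [map_add, map_smul]
    obtain rfl | hi := Finset.mem_insert.1 hi
    · rw [ker_add_smul_swap _ _ hs0]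
      exact (hS' _ fun hmem => hs2 _ hmem (inv_inv s)).trans hy
    · exact (hS i s (hs1 i hi)).trans (hx i hi)

/-- If an alternating form `B₁` does not vanish on the kernel of the alternating form `B₀`, then some
member of the pencil spanned by `B₀` and `B₁` has a kernel of dimension at most that of the kernel
of `B₀` minus two. -/
lemma exists_finrank_ker_add_smul_add_two_le [Infinite K] {V : Type*} [AddCommGroup V]
    [Module K V] [FiniteDimensional K V] {B₀ B₁ : LinearMap.BilinForm K V} (h₀ : B₀.IsAlt)
    (h₁ : B₁.IsAlt) {t v : V} (ht : t ∈ LinearMap.ker B₀) (hv : v ∈ LinearMap.ker B₀)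
    (htv : B₁ t v ≠ 0) :
    ∃ s : K, finrank K (LinearMap.ker (B₀ + s • B₁)) + 2 ≤ finrank K (LinearMap.ker B₀) := by
  obtain ⟨W, hW⟩ := Submodule.exists_isCompl (LinearMap.ker B₀)
  let πN : End K V := (LinearMap.ker B₀).projection W hW
  let πW : End K V := W.projection _ hW.symm
  have hsum : ∀ v, πN v + πW v = v := fun v => by
    simpa using LinearMap.congr_fun (Submodule.projection_add_projection_eq_id hW) v
  have hN : ∀ u, ∀ n ∈ LinearMap.ker B₀, B₀ u n = 0 := fun u n hn => by
    rw [← LinearMap.IsAlt.neg h₀ n u, LinearMap.mem_ker.1 hn, LinearMap.zero_apply, neg_zero]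
  -- Rescaling the second variable by `s⁻¹` on `ker B₀` turns `B₀ + s B₁` into `A + s B`. At `s = 0`
  -- what remains of `B₁` is its effect on `ker B₀`, so `ker A` is the radical of `B₁` restricted to
  -- `ker B₀`.
  let A : LinearMap.BilinForm K V := B₀ + B₁.compl₂ πN
  let B : LinearMap.BilinForm K V := B₁.compl₂ πW
  obtain ⟨S, hS⟩ := exists_finset_finrank_ker_add_smul_le A B
  obtain ⟨s, hs⟩ := (S.finite_toSet.insert 0).exists_notMem
  obtain ⟨hs0, hs⟩ : s ≠ 0 ∧ s ∉ S := by simpa using hs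
  have hle : LinearMap.ker (B₀ + s • B₁) ≤ LinearMap.ker (A + s • B) := by
    intro u hu
    rw [LinearMap.mem_ker] at hu ⊢
    ext w
    have h1 := LinearMap.congr_fun hu (πW w + s⁻¹ • πN w)
    have h2 : B₀ u w = B₀ u (πW w) := by
      conv_lhs => rw [← hsum w, map_add, hN u _ (Submodule.projection_apply_mem _ _), zero_add]
    have h3 : B₀ u (πN w) = 0 := hN u _ (Submodule.projection_apply_mem _ _)
    simp only [LinearMap.add_apply, LinearMap.smul_apply, map_add, map_smul, smul_eq_mul, h3,
      LinearMap.zero_apply, mul_zero, zero_add] at h1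
    simp only [A, B, LinearMap.add_apply, LinearMap.smul_apply, LinearMap.compl₂_apply, h2,
      smul_eq_mul, LinearMap.zero_apply]
    rw [inv_mul_cancel_left₀ hs0] at h1
    rw [← h1]
    ring
  have hA : ∀ u ∈ LinearMap.ker A,
      u ∈ LinearMap.ker B₀ ∧ ∀ n ∈ LinearMap.ker B₀, B₁ u n = 0 := by
    intro u hu
    have hu' : ∀ w, B₀ u w + B₁ u (πN w) = 0 := fun w => LinearMap.congr_fun hu w
    refine ⟨LinearMap.ext fun w => ?_, fun n hn => ?_⟩
    · rw [← hsum w, map_add, hN u _ (Submodule.projection_apply_mem _ _), zero_add]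
      have h1 := hu' (πW w)
      have h2 : πN (πW w) = 0 := by
        rw [Submodule.projection_apply_eq_zero_iff]
        exact Submodule.projection_apply_mem _ _
      rw [h2, map_zero, add_zero] at h1
      exact h1
    · have h1 := hu' n
      rwa [hN u n hn, zero_add, Submodule.projection_apply_of_mem_left _ hn] at h1
  have hspan : Submodule.span K {t, v} ≤ LinearMap.ker B₀ := by
    rw [Submodule.span_le]
    rintro _ (rfl | rfl) <;> assumption
  have hind : LinearIndependent K ![t, v] := by
    rw [LinearIndependent.pair_iff]
    intro a b hab
    have h2 : B₁ t (a • t + b • v) = 0 := by rw [hab, map_zero]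
    have h3 : B₁ v (a • t + b • v) = 0 := by rw [hab, map_zero]
    have h4 : B₁ v t ≠ 0 := by
      rw [← LinearMap.IsAlt.neg h₁ t v]
      exact neg_ne_zero.2 htv
    simp only [map_add, map_smul, h₁ t, h₁ v, smul_eq_mul, mul_zero, zero_add, add_zero] at h2 h3
    exact ⟨(mul_eq_zero.1 h3).resolve_right h4, (mul_eq_zero.1 h2).resolve_right htv⟩
  have hrank : finrank K (Submodule.span K {t, v}) = 2 := by
    have := finrank_span_eq_card hind
    rwa [Matrix.range_cons, Matrix.range_cons, Matrix.range_empty, Set.union_empty,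
      Set.singleton_union] at this
  -- The plane spanned by `t` and `v` is nondegenerate for `B₁`, so it avoids that radical; this is
  -- the gain of two.
  have hdisj : Disjoint (LinearMap.ker A) (Submodule.span K {t, v}) := by
    rw [Submodule.disjoint_def]
    intro u hu hu'
    obtain ⟨a, b, rfl⟩ := Submodule.mem_span_pair.1 hu'
    have h2 := (hA _ hu).2 v hv
    have h3 := (hA _ hu).2 t ht
    have h4 : B₁ v t ≠ 0 := by
      rw [← LinearMap.IsAlt.neg h₁ t v]
      exact neg_ne_zero.2 htv
    simp only [map_add, map_smul, LinearMap.add_apply, LinearMap.smul_apply, h₁ t, h₁ v,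
      smul_eq_mul, mul_zero, zero_add, add_zero] at h2 h3
    rw [(mul_eq_zero.1 h2).resolve_right htv, (mul_eq_zero.1 h3).resolve_right h4, zero_smul,
      zero_smul, add_zero]
  have h5 := Submodule.finrank_sup_add_finrank_inf_eq (LinearMap.ker A) (Submodule.span K {t, v})
  rw [hdisj.eq_bot, finrank_bot, add_zero, hrank] at h5
  have h6 := Submodule.finrank_mono (sup_le (fun u hu => (hA u hu).1) hspan)
  refine ⟨s, ?_⟩
  have h7 := Submodule.finrank_mono hle
  have h8 := hS s hs
  lia

end Pencil

end NilpotentCentralizer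

end

noncomputable section

namespace NilpotentCentralizer

open Module

/-! ### From nonzero minors in the symmetric algebra to small kernels. -/

section Minor

variable {K : Type*} [Field K]

/-- In a basis, `p` is a nonzero polynomial, and over an infinite field it has a nonzero value;
points are linear forms on `V`. -/
lemma exists_lift_ne_zero [Infinite K] {V : Type*} [AddCommGroup V] [Module K V]
    [FiniteDimensional K V] {p : SymmetricAlgebra K V} (hp : p ≠ 0) :
    ∃ x : Dual K V, SymmetricAlgebra.lift x p ≠ 0 := by
  let b := Module.finBasis K V
  let φ := SymmetricAlgebra.equivMvPolynomial b
  by_contra! H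
  apply hp
  apply φ.injective
  rw [map_zero]
  refine MvPolynomial.funext fun c => ?_
  rw [map_zero, ← H (b.constr K c)]
  have : (MvPolynomial.aeval c).comp φ.toAlgHom = SymmetricAlgebra.lift (b.constr K c) := by
    apply SymmetricAlgebra.algHom_ext
    refine b.ext fun i => ?_
    simp [φ]
  rw [← this]
  simp [MvPolynomial.aeval_eq_eval]

variable {V V' : Type*} [AddCommGroup V] [Module K V] [AddCommGroup V'] [Module K V']

lemma finrank_ker_eq_zero_of_det_ne_zero (B : V →ₗ[K] V' →ₗ[K] K) {n : Type*} [Fintype n]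
    [DecidableEq n] (v : Basis n K V) (w : Basis n K V')
    (h : (Matrix.of fun i j => B (v i) (w j)).det ≠ 0) :
    finrank K (LinearMap.ker B) = 0 := by
  suffices LinearMap.ker B = ⊥ by rw [this, finrank_bot]
  rw [LinearMap.ker_eq_bot']
  intro u hu
  have h1 : Matrix.vecMul (v.repr u) (Matrix.of fun i j => B (v i) (w j)) = 0 := by
    ext j
    have : B u (w j) = 0 := by rw [hu, LinearMap.zero_apply]
    rw [← v.sum_repr u, map_sum, LinearMap.sum_apply] at this
    simpa [Matrix.vecMul, dotProduct] using this
  have h2 := Matrix.eq_zero_of_vecMul_eq_zero h h1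
  apply v.repr.injective
  ext i
  simpa using congrFun h2 i

/-- The `i`-th coordinate is injective on the kernel: when it vanishes, the remaining coordinates
are annihilated by an invertible submatrix. -/
lemma finrank_ker_le_one_of_minor_ne_zero (B : V →ₗ[K] V' →ₗ[K] K) {k : ℕ}
    (v : Basis (Fin (k + 1)) K V) (w : Basis (Fin (k + 1)) K V') (i : Fin (k + 1))
    (h : ((Matrix.of fun i j => B (v i) (w j)).submatrix i.succAbove i.succAbove).det ≠ 0) :
    finrank K (LinearMap.ker B) ≤ 1 := by
  have := Module.Finite.of_basis v
  let ψ : LinearMap.ker B →ₗ[K] K := (v.coord i).domRestrict _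
  have hψ : Function.Injective ψ := by
    rw [← LinearMap.ker_eq_bot, LinearMap.ker_eq_bot']
    rintro ⟨u, hu⟩ (hui : v.repr u i = 0)
    apply Subtype.ext
    change u = 0
    have h1 : Matrix.vecMul (fun a => v.repr u (i.succAbove a))
        ((Matrix.of fun i j => B (v i) (w j)).submatrix i.succAbove i.succAbove) = 0 := by
      ext j
      have : B u (w (i.succAbove j)) = 0 := by rw [LinearMap.mem_ker.1 hu, LinearMap.zero_apply]
      rw [← v.sum_repr u, Fin.sum_univ_succAbove _ i, hui, zero_smul, zero_add] at this
      simpa [Matrix.vecMul, dotProduct] using this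
    have h2 := Matrix.eq_zero_of_vecMul_eq_zero h h1
    apply v.repr.injective
    ext a
    rcases Fin.eq_self_or_eq_succAbove i a with rfl | ⟨b, rfl⟩
    · simpa using hui
    · simpa using congrFun h2 b
  simpa using LinearMap.finrank_le_finrank_of_injective hψ

end Minor

/-! ### The forms `x([v, w])` on a graded Lie algebra. -/

section Graded

variable {K L : Type*} [Field K] [LieRing L] [LieAlgebra K L]

variable (K L) in
/-- The alternating form `(v, w) ↦ x([v, w])` on `L`, depending linearly on the linear form `x`. -/
def bracketForm : Dual K L →ₗ[K] LinearMap.BilinForm K L where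
  toFun x := LinearMap.mk₂ K (fun v w => x ⁅v, w⁆) (by simp) (by simp) (by simp) (by simp)
  map_add' x y := by ext; simp
  map_smul' c x := by ext; simp

@[simp] lemma bracketForm_apply (x : Dual K L) (v w : L) : bracketForm K L x v w = x ⁅v, w⁆ := rfl

lemma bracketForm_isAlt (x : Dual K L) : (bracketForm K L x).IsAlt := fun v => by simp

lemma coadjointStabilizer_eq_ker (x : Dual K L) :
    coadjointStabilizer K L x = LinearMap.ker (bracketForm K L x) := by
  ext v
  rw [LinearMap.mem_ker]
  change ⁅v, x⁆ = 0 ↔ _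
  simp [LinearMap.ext_iff]

lemma index_le (x : Dual K L) : index K L ≤ finrank K (LinearMap.ker (bracketForm K L x)) := by
  rw [← coadjointStabilizer_eq_ker]
  exact ciInf_le (OrderBot.bddBelow _) x

variable (K L) in
lemma exists_finrank_ker_eq_index :
    ∃ x : Dual K L, finrank K (LinearMap.ker (bracketForm K L x)) = index K L := by
  obtain ⟨x, hx⟩ := ciInf_mem fun x : Dual K L => finrank K (coadjointStabilizer K L x)
  exact ⟨x, by rw [← coadjointStabilizer_eq_ker]; exact hx⟩

/-- The pairing between the subspaces `U` and `U'` given by `(v, w) ↦ x([v, w])`. -/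
def bracketPairing (U U' : Submodule K L) : Dual K L →ₗ[K] U →ₗ[K] U' →ₗ[K] K where
  toFun x := (bracketForm K L x).domRestrict₁₂ U U'
  map_add' x y := by ext; simp [LinearMap.domRestrict₁₂_apply]
  map_smul' c x := by ext; simp [LinearMap.domRestrict₁₂_apply]

@[simp] lemma bracketPairing_apply (U U' : Submodule K L) (x : Dual K L) (v : U) (w : U') :
    bracketPairing U U' x v w = x ⁅(v : L), (w : L)⁆ := rfl

variable {Γ : Type*} [AddCommGroup Γ] {F : Γ → Submodule K L}

/-- Genericity for a graded Lie algebra: linear forms for which the pairings between opposite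
components have small kernels can be replaced by a single one, which vanishes outside the component
of degree zero. -/
lemma exists_dual_of_graded [Infinite K] [FiniteDimensional K L] (hind : iSupIndep F)
    (htop : ⨆ μ, F μ = ⊤)
    (hF : ∀ μ ν, ∀ v ∈ F μ, ∀ w ∈ F ν, ⁅v, w⁆ ∈ F (μ + ν)) (m : Γ → ℕ)
    (h : ∀ μ, F μ ≠ ⊥ →
      ∃ x, finrank K (LinearMap.ker (bracketPairing (F μ) (F (-μ)) x)) ≤ m μ) :
    ∃ x : Dual K L, (∀ μ ≠ 0, ∀ v ∈ F μ, x v = 0) ∧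
      (∀ μ, finrank K (LinearMap.ker (bracketForm K L x) ⊓ F μ : Submodule K L) ≤ m μ) ∧
      LinearMap.ker (bracketForm K L x) ≤ ⨆ μ, LinearMap.ker (bracketForm K L x) ⊓ F μ := by
  have hfin : {μ | F μ ≠ ⊥}.Finite := WellFoundedGT.finite_ne_bot_of_iSupIndep hind
  obtain ⟨x, hx⟩ := exists_forall_finrank_ker_le
    (fun μ => bracketPairing (F μ) (F (-μ))) m hfin.toFinset (fun μ hμ => h μ (by simpa using hμ))
  have hcompl : IsCompl (F 0) (⨆ μ ≠ 0, F μ) := by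
    refine ⟨hind 0, ?_⟩
    rw [codisjoint_iff, eq_top_iff, ← htop, iSup_le_iff]
    intro μ
    by_cases hμ : μ = 0
    · exact hμ ▸ le_sup_left
    · exact le_sup_of_le_right (le_iSup₂_of_le μ hμ le_rfl)
  -- Composing `x` with the projection to degree 0 leaves the pairings of opposite components
  -- unchanged, since their brackets lie in `F 0`.
  let π := (F 0).projection _ hcompl
  have hπ0 : ∀ v ∈ F 0, π v = v := fun v hv => Submodule.projection_apply_of_mem_left _ hv
  have hπ : ∀ μ ≠ 0, ∀ v ∈ F μ, π v = 0 := fun μ hμ v hv =>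
    (Submodule.projection_apply_eq_zero_iff _).2 (le_iSup₂_of_le (f := fun μ _ => F μ) μ hμ le_rfl hv)
  have hx0 : ∀ μ ≠ 0, ∀ v ∈ F μ, (x ∘ₗ π) v = 0 := fun μ hμ v hv => by
    rw [LinearMap.comp_apply, hπ μ hμ v hv, map_zero]
  refine ⟨x ∘ₗ π, hx0, fun μ => ?_, fun n hn => ?_⟩
  · by_cases hμ : F μ = ⊥
    · rw [hμ, inf_bot_eq, finrank_bot]
      exact Nat.zero_le _
    · refine le_trans ?_ (hx μ (by simpa using hμ))
      let ψ : (LinearMap.ker (bracketForm K L (x ∘ₗ π)) ⊓ F μ : Submodule K L) →ₗ[K]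
          LinearMap.ker (bracketPairing (F μ) (F (-μ)) x) :=
        LinearMap.codRestrict _ (Submodule.inclusion inf_le_right) fun v => by
          rw [LinearMap.mem_ker]
          ext w
          have h1 : (x ∘ₗ π) ⁅(v : L), (w : L)⁆ = 0 := LinearMap.congr_fun v.2.1 (w : L)
          rw [LinearMap.comp_apply, hπ0] at h1
          · exact h1
          · simpa using hF μ (-μ) v v.2.2 w w.2
      refine LinearMap.finrank_le_finrank_of_injective (f := ψ) fun a b hab => ?_
      exact Subtype.ext (congrArg (fun c : LinearMap.ker (bracketPairing (F μ) (F (-μ)) x) =>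
        ((c : F μ) : L)) hab)
  · have hn' : n ∈ ⨆ μ, F μ := by rw [htop]; trivial
    classical
    obtain ⟨g, hg, hgn⟩ := (Submodule.mem_iSup_iff_exists_finsupp _ _).1 hn'
    -- Against a vector of degree `ρ`, only the component of `n` of degree `-ρ` contributes, so each
    -- component inherits the vanishing.
    have key : ∀ ν, g ν ∈ LinearMap.ker (bracketForm K L (x ∘ₗ π)) := by
      intro ν
      have hzero : ∀ μ ρ, μ ≠ -ρ → ∀ w ∈ F ρ, (x ∘ₗ π) ⁅g μ, w⁆ = 0 := fun μ ρ hne w hw =>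
        hx0 (μ + ρ) (fun h0 => hne (eq_neg_of_add_eq_zero_left h0)) _ (hF μ ρ _ (hg μ) _ hw)
      rw [LinearMap.mem_ker]
      ext w
      have hw : w ∈ ⨆ μ, F μ := by rw [htop]; trivial
      rw [LinearMap.zero_apply, bracketForm_apply]
      induction hw using Submodule.iSup_induction' with
      | zero => simp
      | add a b _ _ ha hb => rw [lie_add, map_add, ha, hb, add_zero]
      | mem ρ w hw =>
        by_cases hνρ : ν = -ρ
        · have h1 : (x ∘ₗ π) ⁅n, w⁆ = 0 := LinearMap.congr_fun hn w
          rw [← hgn, Finsupp.sum, sum_lie, map_sum] at h1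
          rw [← h1]
          symm
          refine Finset.sum_eq_single ν (fun μ _ hμ => hzero μ ρ (hνρ ▸ hμ) w hw) fun h0 => ?_
          rw [Finsupp.notMem_support_iff.1 h0, zero_lie, map_zero]
        · exact hzero ν ρ hνρ w hw
    rw [← hgn]
    exact Submodule.sum_mem _ fun μ _ => Submodule.mem_iSup_of_mem μ ⟨key μ, hg μ⟩

end Graded

end NilpotentCentralizer

end

noncomputable section

namespace NilpotentCentralizer

open Module Polynomial

/-! ### Operators satisfying the `sl_2` relations. -/

section Sl2

variable {K V : Type*} [Field K] [AddCommGroup V] [Module K V] {E H F : End K V}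

lemma aeval_apply_of_apply_eq_smul {v : V} {c : K} (h : H v = c • v) (q : K[X]) :
    aeval H q v = q.eval c • v := by
  by_cases hv : v = 0
  · simp [hv]
  · exact Module.End.aeval_apply_of_hasEigenvector ⟨Module.End.mem_eigenspace_iff.2 h, hv⟩

lemma aeval_apply_mem_of_mapsTo {W : Submodule K V} (hW : ∀ w ∈ W, H w ∈ W) (q : K[X]) {w : V}
    (hw : w ∈ W) : aeval H q w ∈ W := by
  induction q using Polynomial.induction_on' with
  | add p q hp hq => simpa using W.add_mem hp hq
  | monomial n a =>
    rw [aeval_monomial, Module.End.mul_apply]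
    refine W.smul_mem a ?_
    induction n with
    | zero => simpa using hw
    | succ n ih => rw [pow_succ', Module.End.mul_apply]; exact hW _ ih

/-- The polynomial `X (X - 1) ⋯ (X - (k - 1))`. -/
def fallingPoly (K : Type*) [Field K] (k : ℕ) : K[X] := ∏ i ∈ Finset.range k, (X - C (i : K))

lemma aeval_fallingPoly_succ (H : End K V) (k : ℕ) (a : V) :
    aeval H (fallingPoly K (k + 1)) a = aeval H (fallingPoly K k) (H a - (k : K) • a) := by
  rw [fallingPoly, Finset.prod_range_succ, ← fallingPoly, map_mul, Module.End.mul_apply]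
  simp [Nat.cast_smul_eq_nsmul]

lemma aeval_fallingPoly_succ' (H : End K V) (k : ℕ) (a : V) :
    aeval H (fallingPoly K (k + 1)) a =
      H (aeval H (fallingPoly K k) a) - (k : K) • aeval H (fallingPoly K k) a := by
  rw [fallingPoly, Finset.prod_range_succ, ← fallingPoly, mul_comm, map_mul, Module.End.mul_apply]
  simp [Nat.cast_smul_eq_nsmul]

lemma eval_fallingPoly_neg_two_ne_zero [CharZero K] (k : ℕ) : (fallingPoly K k).eval (-2) ≠ 0 := by
  rw [fallingPoly, eval_prod, Finset.prod_ne_zero_iff]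
  intro i _
  have : ((i + 2 : ℕ) : K) ≠ 0 := Nat.cast_ne_zero.2 (by lia)
  intro h
  apply this
  push_cast
  simp only [eval_sub, eval_X, eval_C] at h
  linear_combination -h

variable (hHF : ∀ v, H (F v) = F (H v) - (2 : K) • F v)
include hHF

lemma apply_pow_lowering (k : ℕ) (v : V) :
    H ((F ^ k) v) = (F ^ k) (H v) - (2 * k : K) • (F ^ k) v := by
  induction k with
  | zero => simp
  | succ k ih =>
    rw [pow_succ', Module.End.mul_apply, hHF, ih, Module.End.mul_apply, map_sub, map_smul]
    push_cast
    module

/-- Each nonzero power `F ^ k` would be an eigenvector of the commutator with `H`, for the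
eigenvalue `-2k`; only finitely many can occur. -/
lemma isNilpotent_lowering [CharZero K] [FiniteDimensional K V] : IsNilpotent F := by
  by_contra hF
  have hne : ∀ k, F ^ k ≠ 0 := fun k hk => hF ⟨k, hk⟩
  let T : End K (End K V) := LinearMap.mulLeft K H - LinearMap.mulRight K H
  have hT : ∀ k : ℕ, T.HasEigenvalue (-2 * k : K) := by
    intro k
    refine Module.End.hasEigenvalue_of_hasEigenvector (x := F ^ k) ⟨?_, hne k⟩
    rw [Module.End.mem_eigenspace_iff]
    ext v
    simp only [T, LinearMap.sub_apply, LinearMap.mulLeft_apply, LinearMap.mulRight_apply,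
      Module.End.mul_apply, LinearMap.smul_apply]
    rw [apply_pow_lowering hHF]
    module
  have hinj : Function.Injective fun k : ℕ => (-2 * k : K) := fun a b hab => by simpa using hab
  exact Set.infinite_of_injective_forall_mem hinj hT (Module.End.finite_hasEigenvalue T)

variable (hHE : ∀ v, H (E v) = E (H v) + (2 : K) • E v) (hEF : ∀ v, E (F v) = F (E v) + H v)
include hEF

lemma raising_apply_pow_lowering_succ (k : ℕ) (v : V) :
    E ((F ^ (k + 1)) v) =
      (F ^ (k + 1)) (E v) + (k + 1 : K) • (F ^ k) (H v - (k : K) • v) := by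
  induction k generalizing v with
  | zero => simp [hEF]
  | succ k ih =>
    rw [pow_succ, Module.End.mul_apply, ih, hEF, hHF]
    simp only [map_add, map_sub, map_smul, pow_succ, Module.End.mul_apply]
    push_cast
    module

include hHE

/-- The assumption `F (E a) = 0`, weaker than `E a = 0`, is preserved by `H - k`, which drives the
induction. With `F` nilpotent, the formula forces nonnegative integer roots for `H` on such vectors,
without complete reducibility. -/
lemma pow_raising_apply_pow_lowering (k : ℕ) (a : V) (ha : F (E a) = 0) :
    (E ^ k) ((F ^ k) a) = (k.factorial : K) • aeval H (fallingPoly K k) a := by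
  induction k generalizing a with
  | zero => simp [fallingPoly]
  | succ k ih =>
    have h1 : F (E (H a - (k : K) • a)) = 0 := by
      have h2 := hHE a
      have h3 := hHF (E a)
      rw [ha, map_zero, smul_zero, sub_zero] at h3
      have h4 : E (H a) = H (E a) - (2 : K) • E a := by rw [h2]; abel
      rw [map_sub, map_smul, h4, map_sub, map_sub, map_smul, map_smul, ha, ← h3]
      simp
    rw [pow_succ, Module.End.mul_apply, raising_apply_pow_lowering_succ hHF hEF, pow_succ F,
      Module.End.mul_apply, ha, map_zero, zero_add, map_smul, ih _ h1, aeval_fallingPoly_succ,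
      smul_smul, Nat.factorial_succ]
    push_cast
    rfl

lemma exists_aeval_fallingPoly_eq_zero [CharZero K] [FiniteDimensional K V] :
    ∃ N, ∀ a, F (E a) = 0 → aeval H (fallingPoly K N) a = 0 := by
  obtain ⟨N, hN⟩ := isNilpotent_lowering hHF
  refine ⟨N, fun a ha => ?_⟩
  have h1 := pow_raising_apply_pow_lowering hHF hHE hEF N a ha
  rw [hN, LinearMap.zero_apply, map_zero, eq_comm, smul_eq_zero] at h1
  exact h1.resolve_left (Nat.cast_ne_zero.2 N.factorial_ne_zero)

/-- `F x` is killed by `E` and has `H`-weight `-2`, whereas vectors killed by `E` only allow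
nonnegative weights. -/
lemma lowering_apply_eq_zero [CharZero K] [FiniteDimensional K V] {x : V} (hE : E x = 0)
    (hH : H x = 0) : F x = 0 := by
  obtain ⟨N, hN⟩ := exists_aeval_fallingPoly_eq_zero hHF hHE hEF
  have h1 : E (F x) = 0 := by rw [hEF, hE, hH, map_zero, add_zero]
  have h2 := hN (F x) (by rw [h1, map_zero])
  rw [aeval_apply_of_apply_eq_smul (c := -2) (by rw [hHF, hH, map_zero]; module), smul_eq_zero]
    at h2
  exact h2.resolve_left (eval_fallingPoly_neg_two_ne_zero N)

/-- Moving `E` past a polynomial `p(H)` shifts its argument by `-2`, so `E p(H) a = p(-2) E a`. A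
falling product kills `a` and has no root at `-2`. -/
lemma raising_apply_eq_zero [CharZero K] [FiniteDimensional K V] {a : V} (hF : F (E a) = 0)
    (hH : H (E a) = 0) : E a = 0 := by
  obtain ⟨N, hN⟩ := exists_aeval_fallingPoly_eq_zero hHF hHE hEF
  have key : ∀ k, E (aeval H (fallingPoly K k) a) = (fallingPoly K k).eval (-2) • E a := by
    intro k
    induction k with
    | zero => simp [fallingPoly]
    | succ k ih =>
      have h1 : ∀ b, E (H b) = H (E b) - (2 : K) • E b := fun b => by rw [hHE]; abel
      rw [aeval_fallingPoly_succ', map_sub, map_smul, h1, ih, map_smul, hH, fallingPoly,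
        fallingPoly, Finset.prod_range_succ, eval_mul]
      simp only [eval_sub, eval_X, eval_C]
      module
  have h2 := key N
  rw [hN a hF, map_zero, eq_comm, smul_eq_zero] at h2
  exact h2.resolve_left (eval_fallingPoly_neg_two_ne_zero N)

/-- Decomposition of a vector killed by the raising operator into a vector killed by the Cartan
operator and a sum of eigenvectors with positive integer eigenvalues. -/
lemma exists_decomposition_of_raising_eq_zero [CharZero K] [FiniteDimensional K V]
    {W : Submodule K V} (hW : ∀ w ∈ W, H w ∈ W) (hWE : ∀ w ∈ W, E w = 0) {w : V} (hw : w ∈ W) :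
    ∃ w₀ ∈ W, ∃ w₁ ∈ W, w = w₀ + w₁ ∧ H w₀ = 0 ∧
      ∃ n : ℕ, aeval H (∏ i ∈ Finset.range n, (X - C ((i + 1 : ℕ) : K))) w₁ = 0 := by
  obtain ⟨N, hN⟩ := exists_aeval_fallingPoly_eq_zero hHF hHE hEF
  set Q : K[X] := ∏ i ∈ Finset.range N, (X - C ((i + 1 : ℕ) : K)) with hQ
  have hQ0 : Q.eval 0 ≠ 0 := by
    rw [hQ, eval_prod, Finset.prod_ne_zero_iff]
    intro i _
    simpa only [eval_sub, eval_X, eval_C, zero_sub, neg_ne_zero] using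
      Nat.cast_ne_zero.2 i.succ_ne_zero
  -- Using `N + 1` ensures the factor `X` is present even when `N = 0`. Then `Q(H) / Q(0)` projects
  -- onto the part killed by `H`.
  have hPQ : fallingPoly K (N + 1) = X * Q := by
    rw [fallingPoly, Finset.prod_range_succ', mul_comm, hQ]
    simp
  have h1 : H (aeval H Q w) = 0 := by
    have h2 : aeval H (fallingPoly K (N + 1)) w = 0 := by
      rw [aeval_fallingPoly_succ', hN w (by rw [hWE w hw, map_zero]), map_zero, smul_zero, sub_zero]
    rwa [hPQ, map_mul, aeval_X, Module.End.mul_apply] at h2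
  have h3 := aeval_apply_mem_of_mapsTo hW Q hw
  refine ⟨(Q.eval 0)⁻¹ • aeval H Q w, W.smul_mem _ h3, w - (Q.eval 0)⁻¹ • aeval H Q w,
    W.sub_mem hw (W.smul_mem _ h3), by abel, by rw [map_smul, h1, smul_zero], N, ?_⟩
  rw [← hQ, map_sub, map_smul,
    aeval_apply_of_apply_eq_smul (v := aeval H Q w) (c := 0) (by rw [h1, zero_smul]),
    smul_smul, inv_mul_cancel₀ hQ0, one_smul, sub_self]

end Sl2

end NilpotentCentralizer

end

noncomputable section

namespace NilpotentCentralizer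

open Module LieModule

/-! ### The subalgebra `𝔩` and the Killing form. -/

section Reductive

variable {K 𝔤 : Type*} [Field K] [LieRing 𝔤] [LieAlgebra K 𝔤]

lemma mem_centralizerElt {e v : 𝔤} : v ∈ centralizerElt K e ↔ ⁅e, v⁆ = 0 :=
  ⟨fun h => h e rfl, fun h y hy => by rw [Set.mem_singleton_iff.1 hy, h]⟩

lemma mem_reductiveFactor {e f v : 𝔤} :
    v ∈ reductiveFactor K e f ↔ ⁅e, v⁆ = 0 ∧ ⁅f, v⁆ = 0 := by
  rw [LieSubalgebra.mem_inf, mem_centralizerElt, mem_centralizerElt]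

end Reductive

end NilpotentCentralizer

namespace IsSl2Triple

open NilpotentCentralizer Module

variable {K 𝔤 : Type*} [Field K] [LieRing 𝔤] [LieAlgebra K 𝔤]
variable {e h f : 𝔤} (t : IsSl2Triple h e f)
include t

lemma ad_h_ad_f (v : 𝔤) : LieAlgebra.ad K 𝔤 h (LieAlgebra.ad K 𝔤 f v) =
    LieAlgebra.ad K 𝔤 f (LieAlgebra.ad K 𝔤 h v) - (2 : K) • LieAlgebra.ad K 𝔤 f v := by
  simp only [LieAlgebra.ad_apply]
  rw [leibniz_lie, t.lie_lie_smul_f K, neg_lie, smul_lie]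
  abel

lemma ad_h_ad_e (v : 𝔤) : LieAlgebra.ad K 𝔤 h (LieAlgebra.ad K 𝔤 e v) =
    LieAlgebra.ad K 𝔤 e (LieAlgebra.ad K 𝔤 h v) + (2 : K) • LieAlgebra.ad K 𝔤 e v := by
  simp only [LieAlgebra.ad_apply]
  rw [leibniz_lie, t.lie_h_e_smul K, smul_lie]
  abel

lemma ad_e_ad_f (v : 𝔤) : LieAlgebra.ad K 𝔤 e (LieAlgebra.ad K 𝔤 f v) =
    LieAlgebra.ad K 𝔤 f (LieAlgebra.ad K 𝔤 e v) + LieAlgebra.ad K 𝔤 h v := by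
  simp only [LieAlgebra.ad_apply]
  rw [leibniz_lie, t.lie_e_f]
  abel

lemma lie_h_eq_zero {v : 𝔤} (he : ⁅e, v⁆ = 0) (hf : ⁅f, v⁆ = 0) : ⁅h, v⁆ = 0 := by
  rw [← t.lie_e_f, lie_lie, he, hf, lie_zero, lie_zero, sub_zero]

variable [CharZero K] [FiniteDimensional K 𝔤]

/-- An element of a subspace `W` of `𝔤(e)` stable under `ad h` is the sum of an element of
`W ∩ 𝔤(f)` and of eigenvectors of `ad h` in `W` with positive integer eigenvalues. -/
lemma exists_add_of_le_centralizer {W : Submodule K 𝔤} (hW : ∀ w ∈ W, ⁅h, w⁆ ∈ W)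
    (hWe : ∀ w ∈ W, ⁅e, w⁆ = 0) {w : 𝔤} (hw : w ∈ W) :
    ∃ w₀ ∈ W, ∃ w₁ ∈ W, w = w₀ + w₁ ∧ ⁅h, w₀⁆ = 0 ∧ ⁅f, w₀⁆ = 0 ∧
      ∃ n : ℕ, Polynomial.aeval (LieAlgebra.ad K 𝔤 h)
        (∏ i ∈ Finset.range n, (Polynomial.X - Polynomial.C ((i + 1 : ℕ) : K))) w₁ = 0 := by
  obtain ⟨w₀, h₀, w₁, h₁, hww, hh, hn⟩ := exists_decomposition_of_raising_eq_zero
    t.ad_h_ad_f t.ad_h_ad_e t.ad_e_ad_f hW hWe hw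
  exact ⟨w₀, h₀, w₁, h₁, hww, hh,
    lowering_apply_eq_zero t.ad_h_ad_f t.ad_h_ad_e t.ad_e_ad_f (hWe _ h₀) hh, hn⟩

/-- The restriction of the Killing form to `𝔤(e) ∩ 𝔤(f)` is nondegenerate. -/
lemma eq_zero_of_forall_killingForm_eq_zero [LieAlgebra.IsKilling K 𝔤] {x : 𝔤}
    (hx : x ∈ reductiveFactor K e f)
    (hκ : ∀ y ∈ reductiveFactor K e f, killingForm K 𝔤 x y = 0) : x = 0 := by
  obtain ⟨hxe, hxf⟩ := mem_reductiveFactor.1 hx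
  have hxh := t.lie_h_eq_zero hxe hxf
  have hκinv : ∀ u y z : 𝔤, killingForm K 𝔤 ⁅u, y⁆ z = - killingForm K 𝔤 y ⁅u, z⁆ := by
    intro u y z
    rw [← lie_skew, map_neg, LinearMap.neg_apply, LieModule.traceForm_apply_lie_apply]
  -- Since `[h, x] = 0`, the vector `x` is orthogonal to the positive part of `𝔤(e)`, and the
  -- remaining part lies in `𝔩`.
  have horth : ∀ w, ⁅e, w⁆ = 0 → killingForm K 𝔤 x w = 0 := by
    intro w hw
    obtain ⟨w₀, hw₀, w₁, -, rfl, -, hf, n, hn⟩ := t.exists_add_of_le_centralizer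
      (W := LinearMap.ker (LieAlgebra.ad K 𝔤 e))
      (fun w hw => by
        have hw : ⁅e, w⁆ = 0 := hw
        change ⁅e, ⁅h, w⁆⁆ = 0
        rw [leibniz_lie, hw, lie_zero, add_zero, ← lie_skew e h, t.lie_h_e_smul K, neg_lie,
          smul_lie, hw, smul_zero, neg_zero]) (fun w hw => hw) hw
    have hw₁ : killingForm K 𝔤 x w₁ = 0 := by
      have key : ∀ q : Polynomial K, killingForm K 𝔤 x
          (Polynomial.aeval (LieAlgebra.ad K 𝔤 h) q w₁) = q.eval 0 * killingForm K 𝔤 x w₁ := by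
        intro q
        induction q using Polynomial.induction_on' with
        | add p q hp hq => simp [hp, hq, add_mul]
        | monomial n a =>
          cases n with
          | zero => simp
          | succ n =>
            have h1 : killingForm K 𝔤 x ⁅h, (LieAlgebra.ad K 𝔤 h ^ n) w₁⁆ = 0 := by
              rw [← neg_eq_zero, ← hκinv, hxh, map_zero, LinearMap.zero_apply]
            simp [pow_succ', h1]
      have h1 := key (∏ i ∈ Finset.range n, (Polynomial.X - Polynomial.C ((i + 1 : ℕ) : K)))
      rw [hn, map_zero, eq_comm, mul_eq_zero, Polynomial.eval_prod, Finset.prod_eq_zero_iff] at h1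
      refine h1.resolve_left ?_
      rintro ⟨i, -, hi⟩
      rw [Polynomial.eval_sub, Polynomial.eval_X, Polynomial.eval_C, zero_sub, neg_eq_zero] at hi
      exact Nat.cast_ne_zero.2 i.succ_ne_zero hi
    rw [map_add, hw₁, add_zero]
    exact hκ _ (mem_reductiveFactor.2 ⟨hw₀, hf⟩)
  have hnd := LieAlgebra.IsKilling.killingForm_nondegenerate K 𝔤
  have hsymm : LinearMap.BilinForm.IsRefl (killingForm K 𝔤) :=
    (LieModule.traceForm_isSymm K 𝔤 𝔤).isRefl
  -- By invariance, the orthogonal of the range of `ad e` is `𝔤(e)`; taking orthogonals twice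
  -- applies.
  have hrange : x ∈ LinearMap.range (LieAlgebra.ad K 𝔤 e) := by
    rw [← LinearMap.BilinForm.orthogonal_orthogonal hnd hsymm
      (LinearMap.range (LieAlgebra.ad K 𝔤 e)), LinearMap.BilinForm.mem_orthogonal_iff]
    intro y hy
    have hy' : ⁅e, y⁆ = 0 := by
      refine hnd.1 _ fun z => ?_
      rw [hκinv, neg_eq_zero]
      exact hsymm _ _ (LinearMap.BilinForm.mem_orthogonal_iff.1 hy _ ⟨z, rfl⟩)
    exact hsymm _ _ (horth y hy')
  obtain ⟨a, rfl⟩ := hrange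
  exact raising_apply_eq_zero t.ad_h_ad_f t.ad_h_ad_e t.ad_e_ad_f hxf hxh

end IsSl2Triple

namespace NilpotentCentralizer

/-! ### Cartan subalgebras of `𝔩` are abelian. -/

section Cartan

open Module LieModule

variable {K 𝔤 : Type*} [Field K] [LieRing 𝔤] [LieAlgebra K 𝔤]
  [FiniteDimensional K 𝔤] {𝔩 : LieSubalgebra K 𝔤}
  (hκ : ∀ x ∈ 𝔩, (∀ y ∈ 𝔩, killingForm K 𝔤 x y = 0) → x = 0)
  (H : LieSubalgebra K 𝔩) [H.IsCartanSubalgebra]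
include hκ

/-- `𝔩` is the sum of `H` and its positive Fitting component, and `H` is orthogonal to the latter;
nondegeneracy on `𝔩` therefore passes to `H`. -/
lemma ker_traceForm_eq_bot_of_isCartanSubalgebra :
    LinearMap.ker (traceForm K H 𝔤) = ⊥ := by
  rw [LinearMap.ker_eq_bot']
  intro x hx
  suffices ((x : 𝔩) : 𝔤) = 0 from Subtype.ext (Subtype.ext this)
  refine hκ _ (x : 𝔩).2 fun y hy => ?_
  change traceForm K 𝔩 𝔤 (x : 𝔩) ⟨y, hy⟩ = 0
  have hcod := (LieModule.isCompl_genWeightSpace_zero_posFittingComp K H 𝔩).codisjoint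
  have hmem : (⟨y, hy⟩ : 𝔩) ∈ (genWeightSpace 𝔩 (0 : H → K) ⊔ posFittingComp K H 𝔩) := by
    rw [hcod.eq_top]
    trivial
  obtain ⟨y₀, hy₀, y₁, hy₁, hyy⟩ := (LieSubmodule.mem_sup _ _ _).1 hmem
  have hroot : genWeightSpace 𝔩 (0 : H → K) = H.toLieSubmodule :=
    LieAlgebra.rootSpace_zero_eq K 𝔩 H
  rw [← hyy, map_add]
  have h0 : traceForm K 𝔩 𝔤 (x : 𝔩) y₀ = 0 := by
    rw [hroot] at hy₀
    exact LinearMap.congr_fun hx ⟨y₀, hy₀⟩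
  have h1 : traceForm K 𝔩 𝔤 (x : 𝔩) y₁ = 0 := by
    refine eq_zero_of_mem_genWeightSpace_mem_posFitting K H 𝔩 (fun u m n => ?_)
      (by rw [hroot]; exact x.2) hy₁
    change traceForm K 𝔩 𝔤 ⁅(u : 𝔩), m⁆ n = - traceForm K 𝔩 𝔤 m ⁅(u : 𝔩), n⁆
    rw [← lie_skew, map_neg, LinearMap.neg_apply, LieModule.traceForm_apply_lie_apply]
  rw [h0, h1, add_zero]

lemma isLieAbelian_of_isCartanSubalgebra [CharZero K] [IsAlgClosed K] : IsLieAbelian H :=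
  LieModule.isLieAbelian_of_ker_traceForm_eq_bot K H 𝔤
    (ker_traceForm_eq_bot_of_isCartanSubalgebra hκ H)

end Cartan

/-! ### Cartan subalgebras of `𝔩` consist of semisimple elements. -/

section Semisimple

open Module LieModule LieAlgebra

attribute [local instance 100] LieRing.ofAssociativeRing

variable {K 𝔤 : Type*} [Field K] [LieRing 𝔤] [LieAlgebra K 𝔤] [CharZero K] [IsAlgClosed K]
  [FiniteDimensional K 𝔤] [LieAlgebra.IsKilling K 𝔤]

open Module.End in
/-- The Jordan decomposition in a Lie algebra with nondegenerate Killing form: the semisimple part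
of the adjoint action of an element is inner. -/
lemma exists_isSemisimple_ad_isNilpotent_ad_sub (x : 𝔤) :
    ∃ y : 𝔤, (ad K 𝔤 y).IsSemisimple ∧ _root_.IsNilpotent (ad K 𝔤 (x - y)) ∧
      ∀ z : 𝔤, ⁅x, z⁆ = 0 → ⁅y, z⁆ = 0 := by
  obtain ⟨N, -, S, hS₀, hN, hS, hSN⟩ := (ad K 𝔤 x).exists_isNilpotent_isSemisimple
  replace hS₀ : Commute (ad K 𝔤 x) S := Algebra.commute_of_mem_adjoin_self hS₀
  have hN' := hN
  rw [eq_sub_of_add_eq hSN.symm] at hN'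
  have aux {a : K} {y : 𝔤} (hy : y ∈ (ad K 𝔤 x).maxGenEigenspace a) : S y = a • y := by
    rw [maxGenEigenspace_eq] at hy
    rw [apply_eq_of_mem_of_comm_of_isFinitelySemisimple_of_isNil hy hS₀ hS.isFinitelySemisimple
      hN']
  have htop : ⨆ a, (ad K 𝔤 x).maxGenEigenspace a = ⊤ := iSup_maxGenEigenspace_eq_top _
  -- `S` is scalar on generalized eigenspaces of `ad x`, and generalized eigenvalues add under the
  -- bracket. A derivation is inner here.
  have h_der (y z : 𝔤) : S ⁅y, z⁆ = ⁅S y, z⁆ + ⁅y, S z⁆ := by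
    have hy : y ∈ ⨆ a, (ad K 𝔤 x).maxGenEigenspace a := by rw [htop]; trivial
    have hz : z ∈ ⨆ a, (ad K 𝔤 x).maxGenEigenspace a := by rw [htop]; trivial
    induction hy using Submodule.iSup_induction' with
    | mem a y hy =>
      induction hz using Submodule.iSup_induction' with
      | mem b z hz =>
        have hyz : ⁅y, z⁆ ∈ (ad K 𝔤 x).maxGenEigenspace (a + b) :=
          lie_mem_maxGenEigenspace_toEnd hy hz
        rw [aux hy, aux hz, aux hyz, smul_lie, lie_smul, ← add_smul]
      | zero => simp
      | add _ _ _ _ h h' => simp only [lie_add, map_add, h, h']; abel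
    | zero => simp
    | add _ _ _ _ h h' => simp only [add_lie, map_add, h, h']; abel
  replace h_der : ∀ y z : 𝔤, S ⁅y, z⁆ = ⁅y, S z⁆ - ⁅z, S y⁆ := by
    simp_rw [← lie_skew (S _) _, add_comm, ← sub_eq_add_neg] at h_der; assumption
  let S' : LieDerivation K 𝔤 𝔤 := ⟨S, h_der⟩
  obtain ⟨y, hy⟩ := LieDerivation.IsKilling.exists_eq_ad S'
  have hSy : S = ad K 𝔤 y := by rw [← LieDerivation.coe_ad_apply_eq_ad_apply y, hy]
  refine ⟨y, hSy ▸ hS, ?_, fun z hz => ?_⟩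
  · rwa [map_sub, ← hSy, hSN, add_sub_cancel_right]
  · have hz' : z ∈ (ad K 𝔤 x).maxGenEigenspace 0 := by
      rw [mem_maxGenEigenspace]
      exact ⟨1, by simpa using hz⟩
    rw [← ad_apply (R := K), ← hSy, aux hz', zero_smul]

/-- Elements of a Cartan subalgebra of `𝔩` are semisimple in `𝔤` if the Killing form of `𝔤` is
nondegenerate on `𝔩`, and `𝔩` contains the semisimple parts of its elements. -/
lemma isSemisimple_ad_of_mem_isCartanSubalgebra {𝔩 : LieSubalgebra K 𝔤}
    (hκ : ∀ x ∈ 𝔩, (∀ y ∈ 𝔩, killingForm K 𝔤 x y = 0) → x = 0)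
    (hcl : ∀ x ∈ 𝔩, ∀ y : 𝔤, (∀ z : 𝔤, ⁅x, z⁆ = 0 → ⁅y, z⁆ = 0) → y ∈ 𝔩)
    (H : LieSubalgebra K 𝔩) [H.IsCartanSubalgebra] (x : H) :
    (ad K 𝔤 ((x : 𝔩) : 𝔤)).IsSemisimple := by
  have hab := isLieAbelian_of_isCartanSubalgebra hκ H
  obtain ⟨y, hy, hxy, hcomm⟩ := exists_isSemisimple_ad_isNilpotent_ad_sub (K := K) ((x : 𝔩) : 𝔤)
  have hy𝔩 : y ∈ 𝔩 := hcl _ (x : 𝔩).2 y hcomm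
  have hyH : (⟨y, hy𝔩⟩ : 𝔩) ∈ H := by
    suffices (⟨y, hy𝔩⟩ : 𝔩) ∈ H.normalizer by
      rwa [LieSubalgebra.IsCartanSubalgebra.self_normalizing] at this
    rw [LieSubalgebra.mem_normalizer_iff]
    intro z hz
    have h1 : ⁅x, (⟨z, hz⟩ : H)⁆ = 0 := trivial_lie_zero _ _ _ _
    have h2 : ⁅((x : 𝔩) : 𝔤), (z : 𝔤)⁆ = 0 := congrArg (fun u : H => ((u : 𝔩) : 𝔤)) h1
    have h3 : ⁅(⟨y, hy𝔩⟩ : 𝔩), z⁆ = 0 := Subtype.ext (hcomm _ h2)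
    rw [h3]
    exact H.zero_mem
  -- The nilpotent part commutes with `H`, so its product with any element of `H` is nilpotent and
  -- has trace zero.
  have hzero : x - ⟨⟨y, hy𝔩⟩, hyH⟩ = 0 := by
    rw [← Submodule.mem_bot K, ← ker_traceForm_eq_bot_of_isCartanSubalgebra hκ H,
      LinearMap.mem_ker]
    ext z
    have hc : Commute (toEnd K H 𝔤 (x - ⟨⟨y, hy𝔩⟩, hyH⟩)) (toEnd K H 𝔤 z) := by
      rw [commute_iff_lie_eq, ← LieHom.map_lie, trivial_lie_zero, map_zero]
    rw [traceForm_apply_apply, ← Module.End.mul_eq_comp, LinearMap.zero_apply]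
    exact (LinearMap.isNilpotent_trace_of_isNilpotent (hc.isNilpotent_mul_right hxy)).eq_zero
  rw [sub_eq_zero] at hzero
  rw [hzero]
  exact hy

end Semisimple

end NilpotentCentralizer

end

noncomputable section

namespace NilpotentCentralizer

open Module

/-! ### The weight decomposition of `𝔤(e)` and its pairings. -/

section Weights

variable {K 𝔤 : Type*} [Field K] [LieRing 𝔤] [LieAlgebra K 𝔤] {𝔱 : Submodule K 𝔤} {e : 𝔤}

lemma mem_E {μ : Dual K 𝔱} {v : centralizerElt K e} :
    v ∈ E 𝔱 e μ ↔ ∀ s : 𝔱, ⁅(s : 𝔤), (v : 𝔤)⁆ = μ s • (v : 𝔤) := Iff.rfl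

lemma lie_mem_E_add {μ ν : Dual K 𝔱} {v w : centralizerElt K e} (hv : v ∈ E 𝔱 e μ)
    (hw : w ∈ E 𝔱 e ν) : ⁅v, w⁆ ∈ E 𝔱 e (μ + ν) := by
  rw [mem_E] at hv hw ⊢
  intro s
  rw [LieSubalgebra.coe_bracket, leibniz_lie, hv, hw, smul_lie, lie_smul, LinearMap.add_apply,
    add_smul]

lemma isWeightIn_iff {V : Submodule K 𝔤} {μ : Dual K 𝔱} :
    IsWeightIn 𝔱 V μ ↔ ∃ v ∈ V, v ≠ 0 ∧ ∀ s : 𝔱, ⁅(s : 𝔤), v⁆ = μ s • v := by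
  rw [IsWeightIn, Submodule.ne_bot_iff]
  exact ⟨fun ⟨v, hv, h0⟩ => ⟨v, hv.2, h0, hv.1⟩, fun ⟨v, hv, h0, h⟩ => ⟨v, ⟨h, hv⟩, h0⟩⟩

lemma isWeightIn_centralizerElt {μ : Dual K 𝔱} (h : E 𝔱 e μ ≠ ⊥) :
    IsWeightIn 𝔱 (centralizerElt K e).toSubmodule μ := by
  obtain ⟨v, hv, h0⟩ := (Submodule.ne_bot_iff _).1 h
  exact isWeightIn_iff.2 ⟨v, v.2, fun h => h0 (Subtype.ext h), hv⟩

section Decomposition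

variable [IsAlgClosed K] [FiniteDimensional K 𝔤] (he : ∀ s ∈ 𝔱, ⁅e, s⁆ = 0)
  (hss : ∀ s ∈ 𝔱, (LieAlgebra.ad K 𝔤 s).IsSemisimple)
  (hcomm : ∀ s ∈ 𝔱, ∀ s' ∈ 𝔱, ⁅s, s'⁆ = 0)
include he hss hcomm

open Module.End in
lemma iSup_E_eq_top_and_iSupIndep : (⨆ μ, E 𝔱 e μ) = ⊤ ∧ iSupIndep (E 𝔱 e) := by
  have hmaps : ∀ s : 𝔱, ∀ v ∈ (centralizerElt K e).toSubmodule,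
      LieAlgebra.ad K 𝔤 (s : 𝔤) v ∈ (centralizerElt K e).toSubmodule := by
    intro s v hv
    have hv' : ⁅e, v⁆ = 0 := mem_centralizerElt.1 hv
    refine mem_centralizerElt.2 ?_
    rw [LieAlgebra.ad_apply, leibniz_lie, he s s.2, hv', zero_lie, lie_zero, add_zero]
  let T : 𝔱 → End K (centralizerElt K e).toSubmodule := fun s =>
    (LieAlgebra.ad K 𝔤 (s : 𝔤)).restrict (hmaps s)
  have hT : ∀ s, (T s).IsSemisimple := fun s => (hss s s.2).restrict _
  have hTT : ∀ s s', Commute (T s) (T s') := by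
    intro s s'
    ext v
    change ⁅(s : 𝔤), ⁅(s' : 𝔤), (v : 𝔤)⁆⁆ = ⁅(s' : 𝔤), ⁅(s : 𝔤), (v : 𝔤)⁆⁆
    rw [leibniz_lie, hcomm s s.2 s' s'.2, zero_lie, zero_add]
  have hmem : ∀ (χ : 𝔱 → K) (v : (centralizerElt K e).toSubmodule),
      v ∈ ⨅ s, (T s).maxGenEigenspace (χ s) ↔ ∀ s : 𝔱, ⁅(s : 𝔤), (v : 𝔤)⁆ = χ s • (v : 𝔤) := by
    intro χ v
    rw [Submodule.mem_iInf]
    refine forall_congr' fun s => ?_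
    rw [(hT s).isFinitelySemisimple.maxGenEigenspace_eq_eigenspace, mem_eigenspace_iff,
      Subtype.ext_iff]
    rfl
  have hE : ∀ μ : Dual K 𝔱, E 𝔱 e μ = ⨅ s, (T s).maxGenEigenspace (μ s) := fun μ =>
    Submodule.ext fun v => (hmem μ v).symm
  constructor
  · have htop := iSup_iInf_maxGenEigenspace_eq_top_of_iSup_maxGenEigenspace_eq_top_of_commute T
      (fun s s' _ => hTT s s') fun s => iSup_maxGenEigenspace_eq_top (T s)
    rw [eq_top_iff, ← htop, iSup_le_iff]
    intro χ v hv
    by_cases hv0 : v = 0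
    · rw [hv0]
      exact Submodule.zero_mem _
    have hv0' : (v : 𝔤) ≠ 0 := fun h => hv0 (Subtype.ext h)
    rw [hmem] at hv
    -- A family of eigenvalues with a nonzero joint eigenvector is automatically linear.
    let μ : Dual K 𝔱 :=
      { toFun := χ
        map_add' := fun a b => smul_left_injective K hv0' (by
          change χ (a + b) • (v : 𝔤) = (χ a + χ b) • (v : 𝔤)
          rw [← hv, add_smul, ← hv, ← hv, Submodule.coe_add, add_lie])
        map_smul' := fun c a => smul_left_injective K hv0' (by
          change χ (c • a) • (v : 𝔤) = (c * χ a) • (v : 𝔤)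
          rw [← hv, mul_smul, ← hv, Submodule.coe_smul, smul_lie]) }
    exact Submodule.mem_iSup_of_mem μ (mem_E.2 hv)
  · have hind := independent_iInf_maxGenEigenspace_of_forall_mapsTo T fun s s' φ =>
      mapsTo_maxGenEigenspace_of_comm (hTT s' s) φ
    have := hind.comp (f := fun μ : Dual K 𝔱 => (μ : 𝔱 → K)) DFunLike.coe_injective
    exact (funext hE : E 𝔱 e = _) ▸ this

end Decomposition

lemma le_finrank_of_isWeightIn [FiniteDimensional K 𝔤] (hind : iSupIndep (E 𝔱 e))
    {V : Submodule K 𝔤} (hV : V ≤ (centralizerElt K e).toSubmodule) {n : ℕ}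
    (c : Fin n → Dual K 𝔱) (hc : Function.Injective c) (h : ∀ i, IsWeightIn 𝔱 V (c i)) :
    n ≤ finrank K V := by
  choose v hvV hv0 hv using fun i => isWeightIn_iff.1 (h i)
  have h1 : LinearIndependent K fun i => (⟨v i, hV (hvV i)⟩ : centralizerElt K e) :=
    (hind.comp hc).linearIndependent _ (fun i => mem_E.2 (hv i))
      fun i h0 => hv0 i (congrArg Subtype.val h0)
  have h2 : LinearIndependent K v :=
    h1.map' (centralizerElt K e).toSubmodule.subtype (Submodule.ker_subtype _)
  have h3 : LinearIndependent K fun i => (⟨v i, hvV i⟩ : V) :=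
    LinearIndependent.of_comp V.subtype h2
  simpa using h3.fintype_card_le_finrank

/-- `E_0` is `𝔞(e)`, so a linear form realizing the index of `𝔞(e)` can be extended to `𝔤(e)`. -/
lemma exists_finrank_ker_bracketPairing_zero_le [FiniteDimensional K 𝔤] :
    ∃ x, finrank K (LinearMap.ker (bracketPairing (E 𝔱 e 0) (E 𝔱 e (-0)) x)) ≤
      index K (centralizerIn 𝔱 e) := by
  obtain ⟨z, hz⟩ := exists_finrank_ker_eq_index K (centralizerIn 𝔱 e)
  have hle : (centralizerIn 𝔱 e).toSubmodule ≤ (centralizerElt K e).toSubmodule :=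
    fun v hv => hv.2
  obtain ⟨P, hP⟩ := LinearMap.exists_leftInverse_of_injective (Submodule.inclusion hle)
    (LinearMap.ker_eq_bot.2 (Submodule.inclusion_injective hle))
  have hzero : ∀ v : centralizerElt K e, v ∈ E 𝔱 e 0 → (v : 𝔤) ∈ centralizerIn 𝔱 e := by
    intro v hv
    refine ⟨fun s hs => ?_, v.2⟩
    have := mem_E.1 hv ⟨s, hs⟩
    rwa [LinearMap.zero_apply, zero_smul] at this
  have hzero' : ∀ v : centralizerIn 𝔱 e, (⟨v, hle v.2⟩ : centralizerElt K e) ∈ E 𝔱 e (-0) := by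
    intro v s
    rw [neg_zero, LinearMap.zero_apply, zero_smul]
    exact v.2.1 s s.2
  let x : Dual K (centralizerElt K e) := z ∘ₗ P
  refine ⟨x, hz ▸ ?_⟩
  let ψ : LinearMap.ker (bracketPairing (E 𝔱 e 0) (E 𝔱 e (-0)) x) →ₗ[K]
      LinearMap.ker (bracketForm K (centralizerIn 𝔱 e) z) :=
    { toFun := fun v => ⟨⟨((v : E 𝔱 e 0) : centralizerElt K e), hzero _ v.1.2⟩, by
        rw [LinearMap.mem_ker]
        ext w
        have h1 := LinearMap.congr_fun v.2 ⟨_, hzero' w⟩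
        have h2 := LinearMap.congr_fun hP
          ⁅(⟨((v : E 𝔱 e 0) : centralizerElt K e), hzero _ v.1.2⟩ : centralizerIn 𝔱 e), w⁆
        rw [LinearMap.zero_apply, bracketForm_apply]
        rw [LinearMap.zero_apply, bracketPairing_apply] at h1
        refine Eq.trans (congrArg z h2.symm) h1⟩
      map_add' := fun a b => rfl
      map_smul' := fun c a => rfl }
  refine LinearMap.finrank_le_finrank_of_injective (f := ψ) fun a b hab => ?_
  apply Subtype.ext
  apply Subtype.ext
  apply Subtype.ext
  exact congrArg (fun u : LinearMap.ker (bracketForm K (centralizerIn 𝔱 e) z) =>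
    ((u : centralizerIn 𝔱 e) : 𝔤)) hab

section Determinants

variable [Infinite K] [FiniteDimensional K 𝔤] {μ : Dual K 𝔱} {k : ℕ}

lemma exists_det_map_ne_zero {n : Type*} [Fintype n] [DecidableEq n]
    (M : Matrix n n (centralizerElt K e))
    (h : (M.map (SymmetricAlgebra.ι K (centralizerElt K e))).det ≠ 0) :
    ∃ x : Dual K (centralizerElt K e), (M.map x).det ≠ 0 := by
  obtain ⟨x, hx⟩ := exists_lift_ne_zero h
  refine ⟨x, ?_⟩
  rw [AlgHom.map_det, AlgHom.mapMatrix_apply, Matrix.map_map] at hx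
  have : (SymmetricAlgebra.lift x : _ → K) ∘ SymmetricAlgebra.ι K (centralizerElt K e) = x :=
    funext fun v => SymmetricAlgebra.lift_ι_apply x v
  rwa [this] at hx

variable (v : Basis (Fin k) K (E 𝔱 e μ)) (w : Basis (Fin k) K (E 𝔱 e (-μ)))

lemma exists_finrank_ker_bracketPairing_eq_zero (h : (bracketMatrix v w).det ≠ 0) :
    ∃ x, finrank K (LinearMap.ker (bracketPairing (E 𝔱 e μ) (E 𝔱 e (-μ)) x)) = 0 := by
  obtain ⟨x, hx⟩ := exists_det_map_ne_zero (Matrix.of fun i j =>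
    ⁅(v i : centralizerElt K e), (w j : centralizerElt K e)⁆) h
  exact ⟨x, finrank_ker_eq_zero_of_det_ne_zero _ v w hx⟩

/-- Exchanging the two sides transposes the matrix and changes its sign. This serves a weight `μ` of
the top eigenspace whose opposite is not one: condition 3 is then available only at `-μ`. -/
lemma exists_finrank_ker_bracketPairing_swap_eq_zero (h : (bracketMatrix v w).det ≠ 0) :
    ∃ x, finrank K (LinearMap.ker (bracketPairing (E 𝔱 e (-μ)) (E 𝔱 e μ) x)) = 0 := by
  obtain ⟨x, hx⟩ := exists_det_map_ne_zero (Matrix.of fun i j =>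
    ⁅(v i : centralizerElt K e), (w j : centralizerElt K e)⁆) h
  refine ⟨-x, finrank_ker_eq_zero_of_det_ne_zero _ w v ?_⟩
  rw [← Matrix.det_transpose] at hx
  convert hx using 2
  ext i j
  simp only [Matrix.of_apply, Matrix.transpose_apply, Matrix.map_apply, bracketPairing_apply,
    LinearMap.neg_apply]
  rw [← map_neg, lie_skew]

lemma exists_finrank_ker_bracketPairing_le_one (v : Basis (Fin (k + 1)) K (E 𝔱 e μ))
    (w : Basis (Fin (k + 1)) K (E 𝔱 e (-μ))) (i : Fin (k + 1))
    (h : ((bracketMatrix v w).submatrix i.succAbove i.succAbove).det ≠ 0) :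
    ∃ x, finrank K (LinearMap.ker (bracketPairing (E 𝔱 e μ) (E 𝔱 e (-μ)) x)) ≤ 1 := by
  obtain ⟨x, hx⟩ := exists_det_map_ne_zero ((Matrix.of fun i j =>
    ⁅(v i : centralizerElt K e), (w j : centralizerElt K e)⁆).submatrix
      i.succAbove i.succAbove) h
  exact ⟨x, finrank_ker_le_one_of_minor_ne_zero _ v w i hx⟩

end Determinants

end Weights

/-! ### Brackets with eigenvectors of `ad h`. -/

section HighestEigenspace

variable {K 𝔤 : Type*} [Field K] [LieRing 𝔤] [LieAlgebra K 𝔤] {h : 𝔤}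

lemma mem_adEigenspace {d : K} {v : 𝔤} : v ∈ adEigenspace h d ↔ ⁅h, v⁆ = d • v := by
  rw [LinearMap.mem_ker, LinearMap.sub_apply, sub_eq_zero]
  rfl

lemma eq_zero_of_not_hasEigenvalue {c : K} (hc : ¬ (LieAlgebra.ad K 𝔤 h : End K 𝔤).HasEigenvalue c)
    {v : 𝔤} (hv : ⁅h, v⁆ = c • v) : v = 0 := by
  by_contra h0
  exact hc (Module.End.hasEigenvalue_of_hasEigenvector
    ⟨Module.End.mem_eigenspace_iff.2 hv, h0⟩)

/-- Bracketing with `v` shifts `ad h`-eigenvalues by `d`, beyond the spectrum. Peeling off one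
factor at a time avoids splitting `w` into eigenvectors. -/
lemma lie_eq_zero_of_aeval_eq_zero {d : K} {v w : 𝔤} (hv : ⁅h, v⁆ = d • v)
    (hd : ∀ i : ℕ, ¬ (LieAlgebra.ad K 𝔤 h : End K 𝔤).HasEigenvalue (d + (i + 1 : ℕ))) (n : ℕ)
    (hw : Polynomial.aeval (LieAlgebra.ad K 𝔤 h)
        (∏ i ∈ Finset.range n, (Polynomial.X - Polynomial.C ((i + 1 : ℕ) : K))) w = 0) :
    ⁅v, w⁆ = 0 := by
  induction n generalizing w with
  | zero => simp_all
  | succ n ih =>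
    rw [Finset.prod_range_succ, map_mul, Module.End.mul_apply] at hw
    have h1 := ih hw
    rw [map_sub, Polynomial.aeval_X, Polynomial.aeval_C, LinearMap.sub_apply,
      Module.algebraMap_end_apply, LieAlgebra.ad_apply, lie_sub, lie_smul, sub_eq_zero] at h1
    apply eq_zero_of_not_hasEigenvalue (hd n)
    rw [leibniz_lie, hv, smul_lie, h1, add_smul]

end HighestEigenspace

end NilpotentCentralizer

end

noncomputable section

namespace NilpotentCentralizer

open Module

/-! ### Comparison of the indices. -/

section Main

variable {K 𝔤 : Type*} [Field K] [LieRing 𝔤] [LieAlgebra K 𝔤] {e h f : 𝔤} {𝔱 : Submodule K 𝔤} {d : ℤ}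

lemma neg_ne_self_of_ne_zero [CharZero K] {μ : Dual K 𝔱} (hμ : μ ≠ 0) : -μ ≠ μ := by
  intro h
  apply hμ
  ext s
  exact self_eq_neg.1 (LinearMap.congr_fun h s).symm

lemma not_hasEigenvalue_of_isGreatest
    (hd : IsGreatest {m : ℤ | (LieAlgebra.ad K 𝔤 h : End K 𝔤).HasEigenvalue (m : K)} d) (i : ℕ) :
    ¬ (LieAlgebra.ad K 𝔤 h : End K 𝔤).HasEigenvalue ((d : K) + (i + 1 : ℕ)) := by
  intro hi
  have : d + (i + 1 : ℕ) ≤ d := hd.2 (by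
    change (LieAlgebra.ad K 𝔤 h : End K 𝔤).HasEigenvalue _
    push_cast at hi ⊢
    exact hi)
  lia

lemma adEigenspace_le_centralizerElt (t : IsSl2Triple h e f)
    (hd : IsGreatest {m : ℤ | (LieAlgebra.ad K 𝔤 h : End K 𝔤).HasEigenvalue (m : K)} d) :
    adEigenspace h (d : K) ≤ (centralizerElt K e).toSubmodule := by
  intro v hv
  rw [mem_adEigenspace] at hv
  -- The index 1 stands for the eigenvalue `d + 2`, that of `[e, v]`.
  refine mem_centralizerElt.2 (eq_zero_of_not_hasEigenvalue
    (not_hasEigenvalue_of_isGreatest hd 1) ?_)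
  rw [leibniz_lie, t.lie_h_e_smul K, smul_lie, hv, lie_smul]
  push_cast
  module

/-- A vector of weight `μ` in the highest eigenspace of `ad h` commutes with the vectors of weight
`-μ` in `𝔤(e)`, if the highest eigenspace is small. -/
lemma lie_eq_zero_of_mem_adEigenspace [CharZero K] [FiniteDimensional K 𝔤] (t : IsSl2Triple h e f)
    (ht : 𝔱 ≤ (reductiveFactor K e f).toSubmodule) (hind : iSupIndep (E 𝔱 e))
    (hd : IsGreatest {m : ℤ | (LieAlgebra.ad K 𝔤 h : End K 𝔤).HasEigenvalue (m : K)} d)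
    (h1 : finrank K (adEigenspace h (d : K)) ≤ 3)
    (h2 : finrank K (adEigenspace h (d : K)) = 3 → ∀ s ∈ 𝔱, ∀ w ∈ reductiveFactor K e f,
      ⁅s, w⁆ = 0) {μ : Dual K 𝔱} (hμ0 : μ ≠ 0) (hμ : IsWeightIn 𝔱 (adEigenspace h (d : K)) μ)
    (hμ' : IsWeightIn 𝔱 (adEigenspace h (d : K)) (-μ)) {v : 𝔤} (hv : v ∈ adEigenspace h (d : K))
    (hvμ : ∀ s : 𝔱, ⁅(s : 𝔤), v⁆ = μ s • v) {w : 𝔤} (hw : ⁅e, w⁆ = 0)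
    (hwμ : ∀ s : 𝔱, ⁅(s : 𝔤), w⁆ = (-μ) s • w) : ⁅v, w⁆ = 0 := by
  have hth : ∀ s : 𝔱, ⁅(s : 𝔤), h⁆ = 0 := fun s => by
    obtain ⟨hse, hsf⟩ := mem_reductiveFactor.1 (ht s.2)
    rw [← lie_skew, t.lie_h_eq_zero hse hsf, neg_zero]
  have hhv := mem_adEigenspace.1 hv
  obtain ⟨w₀, hw₀, w₁, -, rfl, hhw₀, hfw₀, n, hn⟩ := t.exists_add_of_le_centralizer
    (W := (centralizerElt K e).toSubmodule ⊓ weightSpace 𝔱 (-μ))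
    (fun w ⟨hw, hwμ⟩ => by
      refine ⟨mem_centralizerElt.2 ?_, fun s => ?_⟩
      · have hw : ⁅e, w⁆ = 0 := mem_centralizerElt.1 hw
        rw [leibniz_lie, hw, lie_zero, add_zero, ← lie_skew e h, t.lie_h_e_smul K, neg_lie,
          smul_lie, hw, smul_zero, neg_zero]
      · rw [leibniz_lie, hth, zero_lie, zero_add, hwμ s, lie_smul])
    (fun w hw => mem_centralizerElt.1 hw.1) ⟨mem_centralizerElt.2 hw, hwμ⟩
  have hvw₁ := lie_eq_zero_of_aeval_eq_zero hhv (not_hasEigenvalue_of_isGreatest hd) n hn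
  rw [lie_add, hvw₁, add_zero]
  -- In dimension 3, `𝔱` is central in `𝔩`, so `w₀`, of nonzero weight, vanishes. In smaller
  -- dimension, a nonzero `[v, w₀]` would add the weight 0 to `±μ` in the top eigenspace, which is
  -- one weight too many.
  by_cases h3 : finrank K (adEigenspace h (d : K)) = 3
  · obtain ⟨s, hs⟩ : ∃ s, μ s ≠ 0 := by
      by_contra! H
      exact hμ0 (LinearMap.ext H)
    have h4 := h2 h3 s s.2 w₀ (mem_reductiveFactor.2 ⟨mem_centralizerElt.1 hw₀.1, hfw₀⟩)
    rw [hw₀.2 s, smul_eq_zero, LinearMap.neg_apply, neg_eq_zero] at h4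
    rw [h4.resolve_left hs, lie_zero]
  · by_contra hne
    apply h3
    refine le_antisymm h1 ?_
    refine le_finrank_of_isWeightIn hind (adEigenspace_le_centralizerElt t hd) ![0, μ, -μ] ?_ ?_
    · have h5 := neg_ne_self_of_ne_zero hμ0
      have h6 : -μ ≠ 0 := neg_ne_zero.2 hμ0
      intro i j hij
      fin_cases i <;> fin_cases j <;> simp_all [eq_comm]
    · intro i
      fin_cases i
      · refine isWeightIn_iff.2 ⟨⁅v, w₀⁆, mem_adEigenspace.2 ?_, hne, fun s => ?_⟩
        · rw [leibniz_lie, hhv, hhw₀, lie_zero, add_zero, smul_lie]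
        · rw [leibniz_lie, hvμ, hw₀.2 s, smul_lie, lie_smul]
          simp
      · exact hμ
      · exact hμ'

lemma injective_vec_four {α : Type*} {a b c d : α} (hab : a ≠ b) (hac : a ≠ c) (had : a ≠ d)
    (hbc : b ≠ c) (hbd : b ≠ d) (hcd : c ≠ d) : Function.Injective ![a, b, c, d] := by
  intro i j hij
  fin_cases i <;> fin_cases j <;> simp_all [eq_comm]

open scoped Classical in
/-- The comparison of the indices of `𝔞(e)` and `𝔤(e)` when `𝔱` is contained in
`𝔤(e) ∩ 𝔤(f)` and `𝔤(e)` is the direct sum of its weight spaces for `𝔱`. -/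
theorem index_centralizerElt_le_index_centralizerIn [CharZero K] [FiniteDimensional K 𝔤]
    (hsl2 : IsSl2Triple h e f) (ht : 𝔱 ≤ (reductiveFactor K e f).toSubmodule)
    (htop : ⨆ μ, E 𝔱 e μ = ⊤) (hind : iSupIndep (E 𝔱 e))
    (hd : IsGreatest {m : ℤ | (LieAlgebra.ad K 𝔤 h : End K 𝔤).HasEigenvalue (m : K)} d)
    (h1 : finrank K (adEigenspace h (d : K)) ≤ 3)
    (hcenter : finrank K (adEigenspace h (d : K)) = 3 →
      ∀ s ∈ 𝔱, ∀ w ∈ reductiveFactor K e f, ⁅s, w⁆ = 0)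
    (h3 : ∀ μ : Dual K 𝔱, μ ≠ 0 →
      IsWeightIn 𝔱
        (centralizerElt K e).toSubmodule μ →
      ¬ IsWeightIn 𝔱 (adEigenspace h (d : K)) μ →
      ∃ (k : ℕ) (v : Basis (Fin k) K (E 𝔱 e μ))
        (w : Basis (Fin k) K (E 𝔱 e (-μ))),
        (bracketMatrix v w).det ≠ 0)
    (h4 : ∀ μ : Dual K 𝔱, μ ≠ 0 →
      IsWeightIn 𝔱 (adEigenspace h (d : K)) μ →
      ∃ (k : ℕ) (v : Basis (Fin (k + 1)) K (E 𝔱 e μ))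
        (w : Basis (Fin (k + 1)) K (E 𝔱 e (-μ))) (i : Fin (k + 1)),
        ((bracketMatrix v w).submatrix i.succAbove i.succAbove).det ≠ 0) :
    index K (centralizerElt K e) ≤ index K (centralizerIn 𝔱 e) := by
  have hte : ∀ s ∈ 𝔱, ⁅e, s⁆ = 0 := fun s hs => (mem_reductiveFactor.1 (ht hs)).1
  set V := adEigenspace h (d : K)
  have hV := adEigenspace_le_centralizerElt hsl2 hd
  -- The value 1 is needed only when `μ` and `-μ` both occur in `V`; otherwise a nonzero determinant
  -- at `μ` or at `-μ` gives 0.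
  let m : Dual K 𝔱 → ℕ := fun μ => if μ = 0 then index K (centralizerIn 𝔱 e) else
    if IsWeightIn 𝔱 V μ ∧ IsWeightIn 𝔱 V (-μ) then 1 else 0
  have hgen : ∀ μ, E 𝔱 e μ ≠ ⊥ → ∃ x, finrank K
      (LinearMap.ker (bracketPairing (E 𝔱 e μ) (E 𝔱 e (-μ)) x)) ≤ m μ := by
    intro μ hμ
    by_cases hμ0 : μ = 0
    · subst hμ0
      simpa only [m, if_true] using exists_finrank_ker_bracketPairing_zero_le
    simp only [m, if_neg hμ0]
    by_cases hμV : IsWeightIn 𝔱 V μ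
    · obtain ⟨k, v, w, i, hdet⟩ := h4 μ hμ0 hμV
      by_cases hμV' : IsWeightIn 𝔱 V (-μ)
      · rw [if_pos ⟨hμV, hμV'⟩]
        exact exists_finrank_ker_bracketPairing_le_one v w i hdet
      · rw [if_neg fun H => hμV' H.2]
        have hne : E 𝔱 e (-μ) ≠ ⊥ := (Submodule.ne_bot_iff _).2
          ⟨w i, (w i).2, fun h0 => w.ne_zero i (Subtype.ext h0)⟩
        obtain ⟨k', v', w', hdet'⟩ := h3 (-μ) (neg_ne_zero.2 hμ0)
          (isWeightIn_centralizerElt hne) hμV'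
        obtain ⟨x, hx⟩ := exists_finrank_ker_bracketPairing_swap_eq_zero v' w' hdet'
        rw [neg_neg] at hx
        exact ⟨x, hx.le⟩
    · rw [if_neg fun H => hμV H.1]
      obtain ⟨k, v, w, hdet⟩ := h3 μ hμ0 (isWeightIn_centralizerElt hμ) hμV
      obtain ⟨x, hx⟩ := exists_finrank_ker_bracketPairing_eq_zero v w hdet
      exact ⟨x, hx.le⟩
  obtain ⟨x, hx0, hxm, hxle⟩ := exists_dual_of_graded hind htop
    (fun μ ν v hv w hw => lie_mem_E_add hv hw) m hgen
  set N := LinearMap.ker (bracketForm K (centralizerElt K e) x) with hN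
  have hN0 : finrank K (N ⊓ E 𝔱 e 0 : Submodule K (centralizerElt K e)) ≤
      index K (centralizerIn 𝔱 e) := by
    simpa only [m, if_true] using hxm 0
  have hNbot : ∀ μ ≠ 0, ¬ (IsWeightIn 𝔱 V μ ∧ IsWeightIn 𝔱 V (-μ)) → N ⊓ E 𝔱 e μ = ⊥ := by
    intro μ hμ0 hμ
    rw [← Submodule.finrank_eq_zero (R := K), ← Nat.le_zero]
    simpa only [m, if_neg hμ0, if_neg hμ] using hxm μ
  have hN1 : ∀ μ ≠ 0, finrank K (N ⊓ E 𝔱 e μ : Submodule K (centralizerElt K e)) ≤ 1 := by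
    intro μ hμ0
    refine (hxm μ).trans ?_
    simp only [m, if_neg hμ0]
    split_ifs <;> simp
  by_cases hpair : ∃ μ ≠ 0, IsWeightIn 𝔱 V μ ∧ IsWeightIn 𝔱 V (-μ)
  · obtain ⟨μ, hμ0, hμ, hμ'⟩ := hpair
    -- A second opposite pair would give four distinct weights in `V`.
    have honly : ∀ ν, ν ≠ 0 → ν ≠ μ → ν ≠ -μ → N ⊓ E 𝔱 e ν = ⊥ := by
      intro ν hν0 hνμ hνμ'
      refine hNbot ν hν0 fun hν => ?_
      have h5 := neg_ne_self_of_ne_zero hμ0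
      have h6 := neg_ne_self_of_ne_zero hν0
      have h7 : -ν ≠ μ := fun H => hνμ' (by rw [← H, neg_neg])
      have h8 : -ν ≠ -μ := fun H => hνμ (neg_injective H)
      have h9 : 4 ≤ finrank K V := by
        refine le_finrank_of_isWeightIn hind hV ![μ, -μ, ν, -ν] ?_ ?_
        · exact injective_vec_four h5.symm hνμ.symm h7.symm hνμ'.symm h8.symm h6.symm
        · intro i
          fin_cases i
          exacts [hμ, hμ', hν.1, hν.2]
      lia
    have hNsup : N ≤ (N ⊓ E 𝔱 e 0) ⊔ (N ⊓ E 𝔱 e μ) ⊔ (N ⊓ E 𝔱 e (-μ)) := by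
      refine hxle.trans (iSup_le fun ν => ?_)
      by_cases hν0 : ν = 0
      · subst hν0
        exact le_sup_of_le_left le_sup_left
      by_cases hνμ : ν = μ
      · subst hνμ
        exact le_sup_of_le_left le_sup_right
      by_cases hνμ' : ν = -μ
      · subst hνμ'
        exact le_sup_right
      rw [honly ν hν0 hνμ hνμ']
      exact bot_le
    have hNdim : finrank K N ≤ index K (centralizerIn 𝔱 e) + 2 := by
      have h5 := Submodule.finrank_mono hNsup
      have h6 := Submodule.finrank_add_le_finrank_add_finrank (N ⊓ E 𝔱 e 0 ⊔ N ⊓ E 𝔱 e μ)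
        (N ⊓ E 𝔱 e (-μ))
      have h7 := Submodule.finrank_add_le_finrank_add_finrank (N ⊓ E 𝔱 e 0) (N ⊓ E 𝔱 e μ)
      have h8 := hN1 μ hμ0
      have h9 := hN1 (-μ) (neg_ne_zero.2 hμ0)
      lia
    obtain ⟨v, hvV, hv0, hvμ⟩ := isWeightIn_iff.1 hμ
    obtain ⟨s, hs⟩ : ∃ s, μ s ≠ 0 := by
      by_contra! H
      exact hμ0 (LinearMap.ext H)
    let v' : centralizerElt K e := ⟨v, hV hvV⟩
    let s' : centralizerElt K e := ⟨s, mem_centralizerElt.2 (hte s s.2)⟩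
    have hmemN : ∀ u : centralizerElt K e, (∀ ν, ∀ w ∈ E 𝔱 e ν, x ⁅u, w⁆ = 0) → u ∈ N := by
      intro u hu
      rw [hN, LinearMap.mem_ker]
      ext w
      rw [LinearMap.zero_apply, bracketForm_apply]
      have hw : w ∈ ⨆ ν, E 𝔱 e ν := by rw [htop]; trivial
      induction hw using Submodule.iSup_induction' with
      | mem ν w hw => exact hu ν w hw
      | zero => simp
      | add a b _ _ ha hb => rw [lie_add, map_add, ha, hb, add_zero]
    have hvN : v' ∈ N := by
      refine hmemN v' fun ν w hw => ?_
      by_cases hν : μ + ν = 0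
      · have h5 : ⁅v', w⁆ = 0 := Subtype.ext (lie_eq_zero_of_mem_adEigenspace hsl2 ht hind hd h1
          hcenter hμ0 hμ hμ' hvV hvμ (mem_centralizerElt.1 w.2)
          (by rw [← eq_neg_of_add_eq_zero_right hν]; exact hw))
        rw [h5, map_zero]
      · exact hx0 _ hν _ (lie_mem_E_add (mem_E.2 hvμ) hw)
    -- `s` acts by zero on `E_0`, and by scalars on the other weight spaces, where `x` vanishes.
    have hsN : s' ∈ N := by
      refine hmemN s' fun ν w hw => ?_
      have h5 : ⁅s', w⁆ = ν s • w := Subtype.ext (hw s)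
      rw [h5, map_smul]
      by_cases hν : ν = 0
      · rw [hν, LinearMap.zero_apply, zero_smul]
      · rw [hx0 ν hν w hw, smul_zero]
    obtain ⟨y, hy⟩ : ∃ y : Dual K (centralizerElt K e), y v' ≠ 0 := by
      by_contra! H
      exact hv0 (congrArg Subtype.val ((Module.forall_dual_apply_eq_zero_iff K v').1 H))
    have hsv : bracketForm K _ y s' v' ≠ 0 := by
      have h5 : ⁅s', v'⁆ = μ s • v' := Subtype.ext (hvμ s)
      rw [bracketForm_apply, h5, map_smul]
      exact smul_ne_zero hs hy
    obtain ⟨c, hc⟩ := exists_finrank_ker_add_smul_add_two_le (bracketForm_isAlt x)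
      (bracketForm_isAlt y) hsN hvN hsv
    rw [← map_smul, ← map_add] at hc
    exact (index_le (x + c • y)).trans (Nat.le_of_add_le_add_right (hc.trans hNdim))
  · push Not at hpair
    have hNle : N ≤ N ⊓ E 𝔱 e 0 := by
      refine hxle.trans (iSup_le fun ν => ?_)
      by_cases hν0 : ν = 0
      · rw [hν0]
      · rw [hNbot ν hν0 fun H => hpair ν hν0 H.1 H.2]
        exact bot_le
    exact (index_le x).trans ((Submodule.finrank_mono hNle).trans hN0)

end Main

end NilpotentCentralizer

end

theorem lemma4p9 {K : Type*} [Field K] [IsAlgClosed K] [CharZero K]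
    {𝔤 : Type*} [LieRing 𝔤] [LieAlgebra K 𝔤] [FiniteDimensional K 𝔤] [LieAlgebra.IsSimple K 𝔤]
    (e h f : 𝔤) (hsl2 : IsSl2Triple h e f)
    -- `𝔱` is a subspace of a Cartan subalgebra `H` of `𝔩 = 𝔤(e) ∩ 𝔤(f)`
    (H : LieSubalgebra K (NilpotentCentralizer.reductiveFactor K e f))
    (hH : H.IsCartanSubalgebra)
    (𝔱 : Submodule K 𝔤)
    (h𝔱 : 𝔱 ≤ H.toSubmodule.map (NilpotentCentralizer.reductiveFactor K e f).toSubmodule.subtype)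
    -- `d` is the biggest eigenvalue of `ad h` (the eigenvalues of `ad h` are integers)
    (d : ℤ)
    (hd : IsGreatest {m : ℤ | Module.End.HasEigenvalue
      (LieAlgebra.ad K 𝔤 h : Module.End K 𝔤) (m : K)} d)
    -- (1)
    (h1 : Module.finrank K (NilpotentCentralizer.adEigenspace h (d : K)) ≤ 3)
    (h1' : ¬ ∀ s ∈ 𝔱, ∀ v ∈ NilpotentCentralizer.adEigenspace h (d : K), ⁅s, v⁆ = 0)
    -- (2)
    (h2 : Module.finrank K (NilpotentCentralizer.adEigenspace h (d : K)) = 3 →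
      𝔱 ≤ (LieAlgebra.center K (NilpotentCentralizer.reductiveFactor K e f)).toSubmodule.map
        (NilpotentCentralizer.reductiveFactor K e f).toSubmodule.subtype)
    -- (3)
    (h3 : ∀ μ : Module.Dual K 𝔱, μ ≠ 0 →
      NilpotentCentralizer.IsWeightIn 𝔱
        (NilpotentCentralizer.centralizerElt K e).toSubmodule μ →
      ¬ NilpotentCentralizer.IsWeightIn 𝔱 (NilpotentCentralizer.adEigenspace h (d : K)) μ →
      ∃ (k : ℕ) (v : Module.Basis (Fin k) K (NilpotentCentralizer.E 𝔱 e μ))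
        (w : Module.Basis (Fin k) K (NilpotentCentralizer.E 𝔱 e (-μ))),
        (NilpotentCentralizer.bracketMatrix v w).det ≠ 0)
    -- (4)
    (h4 : ∀ μ : Module.Dual K 𝔱, μ ≠ 0 →
      NilpotentCentralizer.IsWeightIn 𝔱 (NilpotentCentralizer.adEigenspace h (d : K)) μ →
      ∃ (k : ℕ) (v : Module.Basis (Fin (k + 1)) K (NilpotentCentralizer.E 𝔱 e μ))
        (w : Module.Basis (Fin (k + 1)) K (NilpotentCentralizer.E 𝔱 e (-μ))) (i : Fin (k + 1)),
        ((NilpotentCentralizer.bracketMatrix v w).submatrix i.succAbove i.succAbove).det ≠ 0) :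
    NilpotentCentralizer.index K (NilpotentCentralizer.centralizerElt K e) ≤
      NilpotentCentralizer.index K (NilpotentCentralizer.centralizerIn 𝔱 e) := by
  have hK : LieAlgebra.IsKilling K 𝔤 := inferInstance
  have hκ : ∀ x ∈ NilpotentCentralizer.reductiveFactor K e f,
      (∀ y ∈ NilpotentCentralizer.reductiveFactor K e f, killingForm K 𝔤 x y = 0) → x = 0 :=
    fun x hx h => hsl2.eq_zero_of_forall_killingForm_eq_zero hx h
  have hab := NilpotentCentralizer.isLieAbelian_of_isCartanSubalgebra hκ H
  have ht : 𝔱 ≤ (NilpotentCentralizer.reductiveFactor K e f).toSubmodule := fun s hs => by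
    obtain ⟨a, -, rfl⟩ := h𝔱 hs
    exact a.2
  have hte : ∀ s ∈ 𝔱, ⁅e, s⁆ = 0 := fun s hs =>
    (NilpotentCentralizer.mem_reductiveFactor.1 (ht hs)).1
  have hcomm : ∀ s ∈ 𝔱, ∀ s' ∈ 𝔱, ⁅s, s'⁆ = 0 := by
    intro s hs s' hs'
    obtain ⟨a, ha, rfl⟩ := h𝔱 hs
    obtain ⟨b, hb, rfl⟩ := h𝔱 hs'
    have h0 : ⁅(⟨a, ha⟩ : H), (⟨b, hb⟩ : H)⁆ = 0 := trivial_lie_zero _ _ _ _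
    exact congrArg (fun u : H => ((u : NilpotentCentralizer.reductiveFactor K e f) : 𝔤)) h0
  have hss : ∀ s ∈ 𝔱, (LieAlgebra.ad K 𝔤 s).IsSemisimple := by
    intro s hs
    obtain ⟨a, ha, rfl⟩ := h𝔱 hs
    -- `𝔩` contains semisimple parts of its elements because these commute with everything the
    -- element commutes with, in particular with `e` and `f`.
    refine NilpotentCentralizer.isSemisimple_ad_of_mem_isCartanSubalgebra hκ
      (fun x hx y hy => ?_) H ⟨a, ha⟩
    obtain ⟨hxe, hxf⟩ := NilpotentCentralizer.mem_reductiveFactor.1 hx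
    refine NilpotentCentralizer.mem_reductiveFactor.2 ⟨?_, ?_⟩
    · rw [← lie_skew, hy e (by rw [← lie_skew, hxe, neg_zero]), neg_zero]
    · rw [← lie_skew, hy f (by rw [← lie_skew, hxf, neg_zero]), neg_zero]
  obtain ⟨htop, hind⟩ := NilpotentCentralizer.iSup_E_eq_top_and_iSupIndep hte hss hcomm
  have hcenter : Module.finrank K (NilpotentCentralizer.adEigenspace h (d : K)) = 3 →
      ∀ s ∈ 𝔱, ∀ w ∈ NilpotentCentralizer.reductiveFactor K e f, ⁅s, w⁆ = 0 := by
    intro h3 s hs w hw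
    obtain ⟨a, ha, rfl⟩ := h2 h3 hs
    have h0 : ⁅w, (a : 𝔤)⁆ = 0 := congrArg Subtype.val (ha ⟨w, hw⟩)
    change ⁅(a : 𝔤), w⁆ = 0
    rw [← lie_skew, h0, neg_zero]
  exact NilpotentCentralizer.index_centralizerElt_le_index_centralizerIn hsl2 ht htop hind hd h1
    hcenter h3 h4
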